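/- Consider an $n\times n$ input-queued switch in discrete time. Its state is the matrix $q(t)\in\mathbb{Z}_{\ge 0}^{n\times n}$ of queue lengths, and $$q(t+1)=[\,q(t)+a(t)-s(t)\,]^+\quad\text{(entrywise)}.$$ The arrival matrices $a(t)$ are i.i.d. over time with independent entries in $\{0,1,\dots,a_{\max}\}$. The schedule $s(t)$ is a permutation matrix chosen by the MaxWeight rule: given $q(t)$, and independently of $a(t)$, it is chosen among the permutation matrices that maximize $\langle q(t),s\rangle=\sum_{ij}q_{ij}(t)s_{ij}$; ties may be broken in any (possibly random) way depending only on $q(t)$. Let $\mathcal{C}$ be the set of nonnegative $n\times n$ matrices with all row and column sums at most $1$. Let $0\le n_1,n_2<n$, and let $\mathcal{F}_{n_1n_2}$ be the set of $x\in\mathcal{C}$ whose first $n_1$ row sums and first $n_2$ column sums equal $1$. Let $\nu$ lie in the relative interior of $\mathcal{F}_{n_1n_2}$, with $\nu_{ij}>0$ for all $i,j$. For each $0<\epsilon<1$ consider such a switch under MaxWeight whose arrivals have mean matrix $\lambda^{(\epsilon)}=(1-\epsilon)\nu$ and variances $(\sigma^{(\epsilon)}_{ij})^2$, where $a_{\max}$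 does not depend on $\epsilon$ and $(\sigma^{(\epsilon)}_{ij})^2\to\sigma_{ij}^2$ as $\epsilon\downarrow 0$ for all $i,j$. Let $\overline{q}^{(\epsilon)}$ be distributed according to a stationary distribution of the Markov chain of queue lengths. Then $\mathbb{E}[\overline{q}^{(\epsilon)}_{ij}]<\infty$ for all $i,j$ and all $0<\epsilon<1$, $$\lim_{\epsilon\downarrow 0}\epsilon\,\mathbb{E}\Big[\sum_{ij}\overline{q}^{(\epsilon)}_{ij}\Big]=\frac12\sum_{ij}\sigma_{ij}^2\,\zeta_{ij},$$ and $$\lim_{\epsilon\downarrow 0}\epsilon\,\mathbb{E}\big[\overline{q}^{(\epsilon)}_{ij}\big]=0\quad\text{for all } i>n_1,\ j>n_2,$$ where $$\zeta_{ij}=\begin{cases}2-\dfrac{2n-n_1-n_2}{n^2-n_1n_2}& i\le n_1,\ j\le n_2,\\[1ex] 1+\dfrac{n_2}{n^2-n_1n_2}& i\le n_1,\ j>n_2,\\[1ex] 1+\dfrac{n_1}{n^2-n_1n_2}& i>n_1,\ j\le n_2,\\[1ex] 0& i>n_1,\ j>n_2.\end{cases}$$ -/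

import Mathlib

open MeasureTheory ProbabilityTheory Filter Topology
open scoped ENNReal

/-- Queue lengths of an `n × n` input-queued switch: `q i j` is the number of packets waiting at
input port `i` for output port `j`. -/
abbrev QueueState (n : ℕ) := Fin n → Fin n → ℕ

/-- The capacity region: nonnegative rate matrices whose row sums and column sums are at most 1. -/
def capacityRegion (n : ℕ) : Set (Fin n → Fin n → ℝ) :=
  {x | (∀ i j, 0 ≤ x i j) ∧ (∀ i, ∑ j, x i j ≤ 1) ∧ (∀ j, ∑ i, x i j ≤ 1)}

/-- The face of the capacity region on which the first `n₁` input ports (rows) and the first `n₂`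
output ports (columns) are saturated. -/
def saturatedFace (n n₁ n₂ : ℕ) : Set (Fin n → Fin n → ℝ) :=
  {x | x ∈ capacityRegion n ∧ (∀ i : Fin n, (i : ℕ) < n₁ → ∑ j, x i j = 1) ∧
    (∀ j : Fin n, (j : ℕ) < n₂ → ∑ i, x i j = 1)}

/-- A maximal schedule matches input ports with output ports bijectively, so it is a permutation
`s`; this is its `0`-`1` matrix. -/
def scheduleMatrix {n : ℕ} (s : Equiv.Perm (Fin n)) : QueueState n :=
  fun i j => if s i = j then 1 else 0

/-- The weight `⟨q, s⟩` of the schedule `s` at queue lengths `q`. -/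
def scheduleWeight {n : ℕ} (q : QueueState n) (s : Equiv.Perm (Fin n)) : ℕ :=
  ∑ i, ∑ j, q i j * scheduleMatrix s i j

/-- `s` is a schedule of maximum weight at queue lengths `q`. -/
def IsMaxWeight {n : ℕ} (q : QueueState n) (s : Equiv.Perm (Fin n)) : Prop :=
  ∀ s' : Equiv.Perm (Fin n), scheduleWeight q s' ≤ scheduleWeight q s

/-- A (possibly randomized) scheduling rule, which picks a schedule according to a law depending
on the current queue lengths, is a MaxWeight rule if it only ever picks schedules of maximum
weight. Ties may be broken in any way, in particular uniformly at random. -/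
def IsMaxWeightRule {n : ℕ} (rule : QueueState n → PMF (Equiv.Perm (Fin n))) : Prop :=
  ∀ q, ∀ s ∈ (rule q).support, IsMaxWeight q s

/-- Queue lengths in the next time slot, `[q + a - s]⁺` entrywise (subtraction of natural numbers
is truncated at zero). -/
def nextQueue {n : ℕ} (q a : QueueState n) (s : Equiv.Perm (Fin n)) : QueueState n :=
  fun i j => q i j + a i j - scheduleMatrix s i j

/-- The law of the matrix of arrivals in one time slot: independent entries, where the entry
`(i, j)` has law `arr i j`. -/
noncomputable def arrivalLaw {n : ℕ} (arr : Fin n → Fin n → PMF ℕ) : Measure (QueueState n) :=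
  Measure.pi fun i => Measure.pi fun j => (arr i j).toMeasure

/-- The transition kernel of the Markov chain of queue lengths: in state `q` a schedule is drawn
from `rule q`, the arrivals are drawn independently of it from `arrivalLaw arr`, and the chain
moves to `[q + a - s]⁺`. -/
noncomputable def queueKernel {n : ℕ} (arr : Fin n → Fin n → PMF ℕ)
    (rule : QueueState n → PMF (Equiv.Perm (Fin n))) : Kernel (QueueState n) (QueueState n) :=
  Kernel.ofFunOfCountable fun q =>
    ∑ s : Equiv.Perm (Fin n), rule q s • (arrivalLaw arr).map (fun a => nextQueue q a s)

/-- The weights `ζ`. Ports are numbered from `0`, so port `i` is saturated when `i < n₁`. -/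
noncomputable def zetaWeight (n n₁ n₂ : ℕ) (i j : Fin n) : ℝ :=
  if (i : ℕ) < n₁ then
    if (j : ℕ) < n₂ then 2 - (2 * (n : ℝ) - n₁ - n₂) / ((n : ℝ) ^ 2 - n₁ * n₂)
    else 1 + (n₂ : ℝ) / ((n : ℝ) ^ 2 - n₁ * n₂)
  else
    if (j : ℕ) < n₂ then 1 + (n₁ : ℝ) / ((n : ℝ) ^ 2 - n₁ * n₂)
    else 0

/-! ### Matrices as vectors of a Euclidean space -/

/-! Near capacity the queue matrix collapses onto a cone of matrices `wᵢ + w'ⱼ` whose weights live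
on saturated ports, and on that cone a quadratic test function determines the mean total queue
length.

Collapse. Let `p` be the projection of `q` to `polarCone`, so that `‖p‖` is the distance of `q` from
the cone polar to it. Since all entries of `ν` are positive and the other ports have slack, `ν` can
be moved a fixed distance `δ` towards `p` inside the capacity region. By Birkhoff's theorem
MaxWeight does at least as well as these rates, which gives a drift of order `-δ‖p‖`
(`IsSaturating.exists_drift`). Testing stationarity with a truncated fourth power of `‖p‖` bounds
its third moment uniformly for small `ε` (`IsSaturating.exists_moment_bound`).

Drift identity. Let `T` be the orthogonal projection to `portSpace`. Every schedule has the same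
image under `T` as `ν`, so scheduling decisions drop out of the evolution of `T q` except through
unused service. As `‖T q‖²` has constant mean, `2ε E⟨T q, ν⟩` equals a variance term plus `ε²‖T ν‖²`
plus terms with unused service (`IsStationaryLaw.integral_drift`). Moreover `⟨T q, ν⟩ = ⟨T q, 1⟩ /
n`, which is the total queue length over `n` up to the collapse error.

Conclusion. Unused service occurs only where the next queue is empty, so its pairing with `T q` is
at most the distance times the unused service at saturated ports. The latter has mean `O(ε)`
(`IsStationaryLaw.integral_unusedService`) and the distance has bounded second moment, so this term
vanishes (`IsStationaryLaw.abs_integral_unused_le`). Independence of the entries reduces the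
variance term to the diagonal of `T`, which is `ζ / n` (`starProjection_portSpace_diag`). Between
unsaturated ports `T q` is zero, so these queues are part of the collapse error and have bounded
means. -/

/-- Real `n × n` matrices with the Frobenius inner product. -/
abbrev MatrixSpace (n : ℕ) := EuclideanSpace ℝ (Fin n × Fin n)

/-- A real matrix as a vector. -/
noncomputable def toVec {n : ℕ} (x : Fin n → Fin n → ℝ) : MatrixSpace n :=
  WithLp.toLp 2 fun e => x e.1 e.2

/-- A matrix of natural numbers as a vector. -/
noncomputable def natVec {n : ℕ} (q : QueueState n) : MatrixSpace n :=
  toVec fun i j => (q i j : ℝ)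

/-- The amount of service that is wasted because the queues are empty. -/
def unusedService {n : ℕ} (q a : QueueState n) (s : Equiv.Perm (Fin n)) : QueueState n :=
  fun i j => scheduleMatrix s i j - (q i j + a i j)

@[simp] lemma toVec_apply {n : ℕ} (x : Fin n → Fin n → ℝ) (e : Fin n × Fin n) :
    toVec x e = x e.1 e.2 := rfl

@[simp] lemma natVec_apply {n : ℕ} (q : QueueState n) (e : Fin n × Fin n) :
    natVec q e = (q e.1 e.2 : ℝ) := rfl

lemma inner_eq_sum {n : ℕ} (x y : MatrixSpace n) : inner ℝ x y = ∑ i, ∑ j, x (i, j) * y (i, j) := by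
  rw [PiLp.inner_apply, Fintype.sum_prod_type]
  simp [mul_comm]

lemma scheduleMatrix_le_one {n : ℕ} (s : Equiv.Perm (Fin n)) (i j : Fin n) :
    scheduleMatrix s i j ≤ 1 := by
  unfold scheduleMatrix; split_ifs <;> simp

lemma sum_scheduleMatrix_row {n : ℕ} (s : Equiv.Perm (Fin n)) (i : Fin n) :
    ∑ j, (scheduleMatrix s i j : ℝ) = 1 := by
  simp [scheduleMatrix]

lemma sum_scheduleMatrix_col {n : ℕ} (s : Equiv.Perm (Fin n)) (j : Fin n) :
    ∑ i, (scheduleMatrix s i j : ℝ) = 1 := by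
  have : ∀ i, (s i = j ↔ i = s.symm j) := fun i => (Equiv.eq_symm_apply s).symm
  simp [scheduleMatrix, this]

lemma unusedService_le_one {n : ℕ} (q a : QueueState n) (s : Equiv.Perm (Fin n)) (i j : Fin n) :
    unusedService q a s i j ≤ 1 :=
  (Nat.sub_le _ _).trans (scheduleMatrix_le_one s i j)

lemma natVec_nextQueue {n : ℕ} (q a : QueueState n) (s : Equiv.Perm (Fin n)) :
    natVec (nextQueue q a s) =
      natVec q + natVec a - natVec (scheduleMatrix s) + natVec (unusedService q a s) := by
  ext e
  simp only [PiLp.add_apply, PiLp.sub_apply, natVec_apply, nextQueue, unusedService]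
  rcases le_total (scheduleMatrix s e.1 e.2) (q e.1 e.2 + a e.1 e.2) with h | h
  · rw [Nat.sub_eq_zero_of_le h, Nat.cast_sub h]; push_cast; ring
  · rw [Nat.sub_eq_zero_of_le h, Nat.cast_sub h]; push_cast; ring

/-- Service is wasted only at queues that are empty. -/
lemma queue_mul_unusedService {n : ℕ} (q a : QueueState n) (s : Equiv.Perm (Fin n)) (i j : Fin n) :
    q i j * unusedService q a s i j = 0 := by
  have h := scheduleMatrix_le_one s i j
  unfold unusedService
  rcases Nat.eq_zero_or_pos (q i j) with h0 | h0
  · simp [h0]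
  · rw [Nat.sub_eq_zero_of_le (by omega), mul_zero]

/-- Queues at which service is wasted are empty in the next time slot. -/
lemma nextQueue_mul_unusedService {n : ℕ} (q a : QueueState n) (s : Equiv.Perm (Fin n))
    (i j : Fin n) : nextQueue q a s i j * unusedService q a s i j = 0 := by
  unfold unusedService nextQueue
  rcases le_total (scheduleMatrix s i j) (q i j + a i j) with h | h
  · rw [Nat.sub_eq_zero_of_le h, mul_zero]
  · rw [Nat.sub_eq_zero_of_le h, zero_mul]

lemma scheduleWeight_eq_inner {n : ℕ} (q : QueueState n) (s : Equiv.Perm (Fin n)) :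
    (scheduleWeight q s : ℝ) = inner ℝ (natVec q) (natVec (scheduleMatrix s)) := by
  simp [scheduleWeight, inner_eq_sum]

/-! ### MaxWeight schedules and the capacity region -/

/-- A matrix of the capacity region lies below a doubly stochastic one. -/
lemma exists_doublyStochastic_ge {n : ℕ} {y : Fin n → Fin n → ℝ} (hy : y ∈ capacityRegion n) :
    ∃ M ∈ doublyStochastic ℝ (Fin n), ∀ i j, y i j ≤ M i j := by
  obtain ⟨h0, hr, hc⟩ := hy
  set t : ℝ := n - ∑ i, ∑ j, y i j with ht
  have hrow : ∑ i, (1 - ∑ j, y i j) = t := by simp [Finset.sum_sub_distrib, ht]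
  have hcol : ∑ j, (1 - ∑ i, y i j) = t := by
    rw [Finset.sum_sub_distrib, Finset.sum_comm]; simp [ht]
  have ht0 : 0 ≤ t := hrow ▸ Finset.sum_nonneg fun i _ => sub_nonneg.2 (hr i)
  have hz : t = 0 → (∀ i, 1 - ∑ j, y i j = 0) ∧ ∀ j, 1 - ∑ i, y i j = 0 := by
    intro h
    rw [h] at hrow hcol
    exact ⟨fun i => (Finset.sum_eq_zero_iff_of_nonneg fun i _ => sub_nonneg.2 (hr i)).1 hrow i
      (Finset.mem_univ _), fun j => (Finset.sum_eq_zero_iff_of_nonneg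
        fun i _ => sub_nonneg.2 (hc i)).1 hcol j (Finset.mem_univ _)⟩
  -- The row deficits and the column deficits have the same total `t`, so the rank-one matrix of
  -- their products over `t` has exactly the missing row and column sums. If `t = 0` there are no
  -- deficits, and division by zero adds nothing.
  refine ⟨Matrix.of fun i j => y i j + (1 - ∑ j, y i j) * (1 - ∑ i, y i j) / t, ?_, ?_⟩
  · rw [mem_doublyStochastic_iff_sum]
    simp only [Matrix.of_apply]
    refine ⟨fun i j => add_nonneg (h0 i j) (div_nonneg (mul_nonneg (sub_nonneg.2 (hr i))
      (sub_nonneg.2 (hc j))) ht0), fun i => ?_, fun j => ?_⟩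
    · rw [Finset.sum_add_distrib, ← Finset.sum_div, ← Finset.mul_sum, hcol]
      rcases eq_or_ne t 0 with h | h
      · have := (hz h).1 i; rw [this]; simp; linarith
      · field_simp; ring
    · rw [Finset.sum_add_distrib, ← Finset.sum_div, ← Finset.sum_mul, hrow]
      rcases eq_or_ne t 0 with h | h
      · have := (hz h).2 j; rw [this]; simp; linarith
      · field_simp; ring
  · intro i j
    have : 0 ≤ (1 - ∑ j, y i j) * (1 - ∑ i, y i j) / t :=
      div_nonneg (mul_nonneg (sub_nonneg.2 (hr i)) (sub_nonneg.2 (hc j))) ht0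
    simpa using this

/-- By Birkhoff's theorem, MaxWeight schedules maximize the weight over the capacity region. -/
lemma IsMaxWeight.inner_le {n : ℕ} {q : QueueState n} {s : Equiv.Perm (Fin n)}
    (hs : IsMaxWeight q s) {y : Fin n → Fin n → ℝ} (hy : y ∈ capacityRegion n) :
    inner ℝ (natVec q) (toVec y) ≤ inner ℝ (natVec q) (natVec (scheduleMatrix s)) := by
  obtain ⟨M, hM, hyM⟩ := exists_doublyStochastic_ge hy
  have h1 : inner ℝ (natVec q) (toVec y) ≤ inner ℝ (natVec q) (toVec M) := by
    simp only [inner_eq_sum, toVec_apply, natVec_apply]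
    gcongr with i _ j _
    exact hyM i j
  refine h1.trans ?_
  have hM' : M ∈ convexHull ℝ {x | ∃ τ : Equiv.Perm (Fin n), τ.permMatrix ℝ = x} := by
    rw [← doublyStochastic_eq_convexHull_permMatrix]; exact hM
  have hconv : Convex ℝ {M : Matrix (Fin n) (Fin n) ℝ |
      inner ℝ (natVec q) (toVec M) ≤ inner ℝ (natVec q) (natVec (scheduleMatrix s))} := by
    intro A hA B hB a b ha hb hab
    have : toVec (a • A + b • B) = a • toVec A + b • toVec B := rfl
    simp only [Set.mem_ofPred_eq] at hA hB ⊢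
    rw [this, inner_add_right, inner_smul_right, inner_smul_right]
    calc _ ≤ a * inner ℝ (natVec q) (natVec (scheduleMatrix s))
          + b * inner ℝ (natVec q) (natVec (scheduleMatrix s)) := by gcongr
      _ = _ := by rw [← add_mul, hab, one_mul]
  refine convexHull_min ?_ hconv hM'
  rintro _ ⟨τ, rfl⟩
  have : toVec (τ.permMatrix ℝ) = natVec (scheduleMatrix τ) := by
    ext e
    change τ.permMatrix ℝ e.1 e.2 = (scheduleMatrix τ e.1 e.2 : ℝ)
    simp [Equiv.Perm.permMatrix, PEquiv.toMatrix_apply, scheduleMatrix]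
  simp only [Set.mem_ofPred_eq]
  rw [this, ← scheduleWeight_eq_inner, ← scheduleWeight_eq_inner]
  exact_mod_cast hs τ

/-! ### The polar cone of the saturated ports -/

/-- The matrices whose saturated row and column sums are nonpositive. -/
def polarCone (n n₁ n₂ : ℕ) : Set (MatrixSpace n) :=
  {y | (∀ i : Fin n, (i : ℕ) < n₁ → ∑ j, y (i, j) ≤ 0) ∧
    (∀ j : Fin n, (j : ℕ) < n₂ → ∑ i, y (i, j) ≤ 0)}

/-- The matrices whose saturated row and column sums vanish. -/
def nullSpace (n n₁ n₂ : ℕ) : Submodule ℝ (MatrixSpace n) where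
  carrier := {y | (∀ i : Fin n, (i : ℕ) < n₁ → ∑ j, y (i, j) = 0) ∧
    (∀ j : Fin n, (j : ℕ) < n₂ → ∑ i, y (i, j) = 0)}
  add_mem' := by
    rintro a b ⟨h1, h2⟩ ⟨h3, h4⟩
    refine ⟨fun i hi => ?_, fun j hj => ?_⟩
    · simp [Finset.sum_add_distrib, h1 i hi, h3 i hi]
    · simp [Finset.sum_add_distrib, h2 j hj, h4 j hj]
  zero_mem' := by simp
  smul_mem' := by
    rintro c a ⟨h1, h2⟩
    refine ⟨fun i hi => ?_, fun j hj => ?_⟩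
    · simp [← Finset.mul_sum, h1 i hi]
    · simp [← Finset.mul_sum, h2 j hj]

lemma nullSpace_subset_polarCone {n n₁ n₂ : ℕ} {y : MatrixSpace n} (hy : y ∈ nullSpace n n₁ n₂) :
    y ∈ polarCone n n₁ n₂ :=
  ⟨fun i hi => (hy.1 i hi).le, fun j hj => (hy.2 j hj).le⟩

lemma convex_polarCone (n n₁ n₂ : ℕ) : Convex ℝ (polarCone n n₁ n₂) := by
  rintro x ⟨h1, h2⟩ y ⟨h3, h4⟩ a b ha hb -
  refine ⟨fun i hi => ?_, fun j hj => ?_⟩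
  · have := add_nonpos (mul_nonpos_of_nonneg_of_nonpos ha (h1 i hi))
      (mul_nonpos_of_nonneg_of_nonpos hb (h3 i hi))
    simpa [Finset.sum_add_distrib, ← Finset.mul_sum] using this
  · have := add_nonpos (mul_nonpos_of_nonneg_of_nonpos ha (h2 j hj))
      (mul_nonpos_of_nonneg_of_nonpos hb (h4 j hj))
    simpa [Finset.sum_add_distrib, ← Finset.mul_sum] using this

lemma smul_mem_polarCone {n n₁ n₂ : ℕ} {y : MatrixSpace n} (hy : y ∈ polarCone n n₁ n₂) {c : ℝ}
    (hc : 0 ≤ c) : c • y ∈ polarCone n n₁ n₂ := by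
  refine ⟨fun i hi => ?_, fun j hj => ?_⟩
  · simpa [← Finset.mul_sum] using mul_nonpos_of_nonneg_of_nonpos hc (hy.1 i hi)
  · simpa [← Finset.mul_sum] using mul_nonpos_of_nonneg_of_nonpos hc (hy.2 j hj)

lemma add_mem_polarCone {n n₁ n₂ : ℕ} {x y : MatrixSpace n} (hx : x ∈ polarCone n n₁ n₂)
    (hy : y ∈ polarCone n n₁ n₂) : x + y ∈ polarCone n n₁ n₂ := by
  refine ⟨fun i hi => ?_, fun j hj => ?_⟩
  · simpa [Finset.sum_add_distrib] using add_nonpos (hx.1 i hi) (hy.1 i hi)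
  · simpa [Finset.sum_add_distrib] using add_nonpos (hx.2 j hj) (hy.2 j hj)

lemma isClosed_polarCone (n n₁ n₂ : ℕ) : IsClosed (polarCone n n₁ n₂) := by
  simp only [polarCone, Set.ofPred_and, Set.ofPred_forall]
  refine IsClosed.inter ?_ ?_
  · exact isClosed_iInter fun i => isClosed_iInter fun _ =>
      isClosed_le (by fun_prop) continuous_const
  · exact isClosed_iInter fun i => isClosed_iInter fun _ =>
      isClosed_le (by fun_prop) continuous_const

/-- Moreau decomposition with respect to the polar cone. -/
lemma exists_polar_decomposition (n n₁ n₂ : ℕ) (x : MatrixSpace n) :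
    ∃ p ∈ polarCone n n₁ n₂, (∀ y ∈ polarCone n n₁ n₂, inner ℝ (x - p) y ≤ 0) ∧
      inner ℝ (x - p) p = 0 := by
  have h0 : (0 : MatrixSpace n) ∈ polarCone n n₁ n₂ :=
    nullSpace_subset_polarCone (Submodule.zero_mem _)
  obtain ⟨p, hp, hmin⟩ := exists_norm_eq_iInf_of_complete_convex ⟨0, h0⟩
    (isClosed_polarCone n n₁ n₂).isComplete (convex_polarCone n n₁ n₂) x
  rw [norm_eq_iInf_iff_real_inner_le_zero (convex_polarCone n n₁ n₂) hp] at hmin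
  refine ⟨p, hp, fun y hy => ?_, ?_⟩
  · simpa using hmin (y + p) (add_mem_polarCone hy hp)
  -- The variational inequality at `2p` and at `0` gives the two signs.
  · refine le_antisymm ?_ ?_
    · have := hmin ((2 : ℝ) • p) (smul_mem_polarCone hp (by norm_num))
      simpa [two_smul] using this
    · simpa using hmin 0 h0

/-- The projection of a matrix to the polar cone. -/
noncomputable def polarPart (n n₁ n₂ : ℕ) (x : MatrixSpace n) : MatrixSpace n :=
  (exists_polar_decomposition n n₁ n₂ x).choose

lemma polarPart_mem {n : ℕ} (n₁ n₂ : ℕ) (x : MatrixSpace n) :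
    polarPart n n₁ n₂ x ∈ polarCone n n₁ n₂ :=
  (exists_polar_decomposition n n₁ n₂ x).choose_spec.1

lemma inner_sub_polarPart_nonpos {n n₁ n₂ : ℕ} (x : MatrixSpace n) {y : MatrixSpace n}
    (hy : y ∈ polarCone n n₁ n₂) : inner ℝ (x - polarPart n n₁ n₂ x) y ≤ 0 :=
  (exists_polar_decomposition n n₁ n₂ x).choose_spec.2.1 y hy

lemma inner_sub_polarPart_self {n : ℕ} (n₁ n₂ : ℕ) (x : MatrixSpace n) :
    inner ℝ (x - polarPart n n₁ n₂ x) (polarPart n n₁ n₂ x) = 0 :=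
  (exists_polar_decomposition n n₁ n₂ x).choose_spec.2.2

/-- `nullSpace` is a linear subspace inside the polar cone, so the one-sided inequality can be
applied to both `y` and `-y`. -/
lemma sub_polarPart_mem {n : ℕ} (n₁ n₂ : ℕ) (x : MatrixSpace n) :
    x - polarPart n n₁ n₂ x ∈ (nullSpace n n₁ n₂)ᗮ := by
  rw [Submodule.mem_orthogonal']
  intro y hy
  refine le_antisymm (inner_sub_polarPart_nonpos x (nullSpace_subset_polarCone hy)) ?_
  have := inner_sub_polarPart_nonpos x (nullSpace_subset_polarCone (Submodule.neg_mem _ hy))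
  rw [inner_neg_right] at this
  linarith

lemma inner_polarPart_self {n : ℕ} (n₁ n₂ : ℕ) (x : MatrixSpace n) :
    inner ℝ x (polarPart n n₁ n₂ x) = ‖polarPart n n₁ n₂ x‖ ^ 2 := by
  have := inner_sub_polarPart_self n₁ n₂ x
  rw [inner_sub_left, real_inner_self_eq_norm_sq] at this
  linarith

/-- The distance to the cone dual to the polar cone is nonexpansive. -/
lemma norm_polarPart_add_le {n : ℕ} (n₁ n₂ : ℕ) (x z : MatrixSpace n) :
    ‖polarPart n n₁ n₂ (x + z)‖ ≤ ‖polarPart n n₁ n₂ x + z‖ := by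
  set p := polarPart n n₁ n₂ x with hp
  set p' := polarPart n n₁ n₂ (x + z) with hp'
  have h1 : inner ℝ (x + z) p' = ‖p'‖ ^ 2 := inner_polarPart_self n₁ n₂ (x + z)
  -- This term can be dropped from `⟨x + z, p'⟩ = ‖p'‖²`, leaving `‖p'‖² ≤ ⟨p + z, p'⟩`;
  -- Cauchy–Schwarz finishes.
  have h2 : inner ℝ (x - p) p' ≤ 0 := inner_sub_polarPart_nonpos x (polarPart_mem n₁ n₂ _)
  have h3 : inner ℝ (p + z) p' ≤ ‖p + z‖ * ‖p'‖ := real_inner_le_norm _ _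
  have h4 : inner ℝ (x + z) p' = inner ℝ (x - p) p' + inner ℝ (p + z) p' := by
    rw [← inner_add_left]; congr 1; abel
  rcases eq_or_lt_of_le (norm_nonneg p') with h | h
  · rw [← h]; positivity
  · nlinarith

/-- The matrices `wᵢ + w'ⱼ` with weights supported on the saturated ports. -/
noncomputable def portSpace (n n₁ n₂ : ℕ) : Submodule ℝ (MatrixSpace n) :=
  (nullSpace n n₁ n₂).orthogonal

/-- The point `x - polarPart x` already lies in `portSpace`, so the subspace is at least as near as
the cone. This carries the collapse estimates over to the linear projection. -/
lemma norm_sub_starProjection_le {n : ℕ} (n₁ n₂ : ℕ) (x : MatrixSpace n) :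
    ‖x - (portSpace n n₁ n₂).starProjection x‖ ≤ ‖polarPart n n₁ n₂ x‖ := by
  rw [Submodule.starProjection_minimal]
  have h := ciInf_le (f := fun y : portSpace n n₁ n₂ => ‖x - y‖)
    ⟨0, by rintro _ ⟨y, rfl⟩; exact norm_nonneg _⟩ ⟨_, sub_polarPart_mem n₁ n₂ x⟩
  simpa using h

/-! ### Drift towards the cone -/

/-- Strictly positive rates that saturate exactly the first `n₁` rows and `n₂` columns. -/
structure IsSaturating (n n₁ n₂ : ℕ) (ν : Fin n → Fin n → ℝ) : Prop where
  pos : ∀ i j, 0 < ν i j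
  row_eq : ∀ i : Fin n, (i : ℕ) < n₁ → ∑ j, ν i j = 1
  col_eq : ∀ j : Fin n, (j : ℕ) < n₂ → ∑ i, ν i j = 1
  row_lt : ∀ i : Fin n, n₁ ≤ (i : ℕ) → ∑ j, ν i j < 1
  col_lt : ∀ j : Fin n, n₂ ≤ (j : ℕ) → ∑ i, ν i j < 1

/-- At an entry between an unsaturated row and an unsaturated column, some mass can be added without
leaving the face; hence both sums were below 1. Such entries exist because `n₁, n₂ < n`. -/
lemma isSaturating_of_mem_intrinsicInterior {n n₁ n₂ : ℕ} (hn₁ : n₁ < n) (hn₂ : n₂ < n)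
    {ν : Fin n → Fin n → ℝ} (hν : ν ∈ intrinsicInterior ℝ (saturatedFace n n₁ n₂))
    (hpos : ∀ i j, 0 < ν i j) : IsSaturating n n₁ n₂ ν := by
  have hmem : ν ∈ saturatedFace n n₁ n₂ := intrinsicInterior_subset hν
  obtain ⟨⟨h0, hr, hc⟩, hr1, hc1⟩ := hmem
  have hsum : ∀ (k l i : Fin n) (c : ℝ), ∑ j, (ν + c • (fun i j => if i = k ∧ j = l then (1 : ℝ) else 0)) i j
      = ∑ j, ν i j + if i = k then c else 0 := by
    intro k l i c
    simp only [Pi.add_apply, Pi.smul_apply, smul_eq_mul, Finset.sum_add_distrib, ← Finset.mul_sum]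
    split_ifs with h <;> simp [h]
  have hsum' : ∀ (k l j : Fin n) (c : ℝ), ∑ i, (ν + c • (fun i j => if i = k ∧ j = l then (1 : ℝ) else 0)) i j
      = ∑ i, ν i j + if j = l then c else 0 := by
    intro k l i c
    simp only [Pi.add_apply, Pi.smul_apply, smul_eq_mul, Finset.sum_add_distrib, ← Finset.mul_sum]
    split_ifs with h <;> simp [h]
  have key : ∀ k l : Fin n, n₁ ≤ (k : ℕ) → n₂ ≤ (l : ℕ) → ∃ c : ℝ, 0 < c ∧
      ν + c • (fun i j => if i = k ∧ j = l then (1 : ℝ) else 0) ∈ saturatedFace n n₁ n₂ := by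
    intro k l hk hl
    set v : Fin n → Fin n → ℝ := fun i j => if i = k ∧ j = l then (1 : ℝ) else 0 with hv
    -- Deleting the entry `(k, l)` gives a second point of the face, so the affine span contains the
    -- whole line in direction `v`, and relative interiority permits a positive step along it.
    have hneg : ν + (-ν k l) • v ∈ saturatedFace n n₁ n₂ := by
      refine ⟨⟨fun i j => ?_, fun i => ?_, fun j => ?_⟩, fun i hi => ?_, fun j hj => ?_⟩
      · by_cases h : i = k ∧ j = l
        · simp [hv, h]
        · simp [hv, h, h0]
      · rw [hsum]; split_ifs <;> linarith [hr i, hpos k l]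
      · rw [hsum']; split_ifs <;> linarith [hc j, hpos k l]
      · rw [hsum, if_neg (by rintro rfl; omega), hr1 i hi, add_zero]
      · rw [hsum', if_neg (by rintro rfl; omega), hc1 j hj, add_zero]
    rw [mem_intrinsicInterior] at hν
    obtain ⟨y, hy, hyν⟩ := hν
    have hline : ∀ c : ℝ, ν + c • v ∈ affineSpan ℝ (saturatedFace n n₁ n₂) := by
      intro c
      have h := AffineMap.lineMap_mem (-c / ν k l) (hyν ▸ y.2) (subset_affineSpan ℝ _ hneg)
      convert h using 1
      rw [AffineMap.lineMap_apply]
      have := (hpos k l).ne'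
      simp only [vsub_eq_sub, vadd_eq_add, add_sub_cancel_left, smul_smul]
      rw [add_comm]
      congr 2
      field_simp
    let γ : ℝ → affineSpan ℝ (saturatedFace n n₁ n₂) := fun c => ⟨ν + c • v, hline c⟩
    have hγ : Continuous γ := by
      refine Continuous.subtype_mk ?_ _
      fun_prop
    have hγ0 : γ 0 = y := Subtype.ext (by simp [γ, hyν])
    have hnhds : ∀ᶠ c in 𝓝 (0 : ℝ), γ c ∈ (Subtype.val ⁻¹' saturatedFace n n₁ n₂ :
        Set (affineSpan ℝ (saturatedFace n n₁ n₂))) :=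
      hγ.continuousAt.eventually_mem (by rw [hγ0]; exact mem_interior_iff_mem_nhds.1 hy)
    obtain ⟨c, hc, hc0⟩ := ((hnhds.filter_mono nhdsWithin_le_nhds).and
      (self_mem_nhdsWithin : Set.Ioi (0 : ℝ) ∈ 𝓝[>] 0)).exists
    exact ⟨c, hc0, hc⟩
  refine ⟨hpos, hr1, hc1, fun i hi => ?_, fun j hj => ?_⟩
  · obtain ⟨c, hc, hm⟩ := key i ⟨n₂, hn₂⟩ hi le_rfl
    have := hm.1.2.1 i
    rw [hsum, if_pos rfl] at this
    linarith
  · obtain ⟨c, hc, hm⟩ := key ⟨n₁, hn₁⟩ j le_rfl hj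
    have := hm.1.2.2 j
    rw [hsum', if_pos rfl] at this
    linarith

/-- Both matrices have sum 1 on every saturated port. Hence the choice of schedule is invisible to
`portSpace`. -/
lemma sub_schedule_mem_nullSpace {n n₁ n₂ : ℕ} {ν : Fin n → Fin n → ℝ}
    (hν : IsSaturating n n₁ n₂ ν) (s : Equiv.Perm (Fin n)) :
    toVec ν - natVec (scheduleMatrix s) ∈ nullSpace n n₁ n₂ := by
  refine ⟨fun i hi => ?_, fun j hj => ?_⟩
  · simp [Finset.sum_sub_distrib, hν.row_eq i hi, sum_scheduleMatrix_row]
  · simp [Finset.sum_sub_distrib, hν.col_eq j hj, sum_scheduleMatrix_col]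

/-- Rates that saturate exactly the given ports can be perturbed in all directions of the
polar cone. -/
lemma IsSaturating.exists_perturbation {n n₁ n₂ : ℕ} {ν : Fin n → Fin n → ℝ}
    (hν : IsSaturating n n₁ n₂ ν) : ∃ δ > 0, ∀ y ∈ polarCone n n₁ n₂, ‖y‖ ≤ 1 →
      (fun i j => ν i j + δ * y (i, j)) ∈ capacityRegion n := by
  have h1 : ∀ c : ℝ, 0 < c → ∀ k : ℝ, ∀ᶠ δ in 𝓝[>] (0 : ℝ), k * δ < c := by
    intro c hc k
    have : Tendsto (fun δ : ℝ => k * δ) (𝓝[>] 0) (𝓝 0) := by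
      have : Continuous fun δ : ℝ => k * δ := by fun_prop
      simpa using (this.tendsto 0).mono_left nhdsWithin_le_nhds
    exact this.eventually (gt_mem_nhds hc)
  -- Entries of `y` are at most 1 in absolute value and its row and column sums at most `n`, so `δ`
  -- must stay below each entry of `ν` and `n * δ` below each slack.
  have e1 : ∀ᶠ δ in 𝓝[>] (0 : ℝ), ∀ i j, 1 * δ < ν i j :=
    eventually_all.2 fun i => eventually_all.2 fun j => h1 _ (hν.pos i j) 1
  have e2 : ∀ᶠ δ in 𝓝[>] (0 : ℝ), ∀ i : Fin n, n₁ ≤ (i : ℕ) → (n : ℝ) * δ < 1 - ∑ j, ν i j :=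
    eventually_all.2 fun i => by
      by_cases hi : n₁ ≤ (i : ℕ)
      · filter_upwards [h1 _ (sub_pos.2 (hν.row_lt i hi)) n] with δ hδ _ using hδ
      · exact Eventually.of_forall fun _ h => absurd h hi
  have e3 : ∀ᶠ δ in 𝓝[>] (0 : ℝ), ∀ j : Fin n, n₂ ≤ (j : ℕ) → (n : ℝ) * δ < 1 - ∑ i, ν i j :=
    eventually_all.2 fun i => by
      by_cases hi : n₂ ≤ (i : ℕ)
      · filter_upwards [h1 _ (sub_pos.2 (hν.col_lt i hi)) n] with δ hδ _ using hδ
      · exact Eventually.of_forall fun _ h => absurd h hi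
  obtain ⟨δ, ⟨⟨d1, d2⟩, d3⟩, hδ⟩ := (((e1.and e2).and e3).and
    (self_mem_nhdsWithin : Set.Ioi (0 : ℝ) ∈ 𝓝[>] 0)).exists
  have hδ : 0 < δ := hδ
  refine ⟨δ, hδ, fun y hy hy1 => ?_⟩
  have hab : ∀ e, |y e| ≤ 1 := fun e => (PiLp.norm_apply_le y e).trans hy1
  have hsum1 : ∀ i, ∑ j, y (i, j) ≤ n := fun i => by
    simpa using Finset.sum_le_card_nsmul Finset.univ (fun j => y (i, j)) 1
      fun j _ => (abs_le.1 (hab _)).2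
  have hsum2 : ∀ j, ∑ i, y (i, j) ≤ n := fun j => by
    simpa using Finset.sum_le_card_nsmul Finset.univ (fun i => y (i, j)) 1
      fun i _ => (abs_le.1 (hab _)).2
  refine ⟨fun i j => ?_, fun i => ?_, fun j => ?_⟩
  · have := (abs_le.1 (hab (i, j))).1
    nlinarith [d1 i j]
  · rw [Finset.sum_add_distrib, ← Finset.mul_sum]
    rcases lt_or_ge (i : ℕ) n₁ with hi | hi
    · nlinarith [hν.row_eq i hi, hy.1 i hi]
    · nlinarith [d2 i hi, hsum1 i]
  · rw [Finset.sum_add_distrib, ← Finset.mul_sum]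
    rcases lt_or_ge (j : ℕ) n₂ with hj | hj
    · nlinarith [hν.col_eq j hj, hy.2 j hj]
    · nlinarith [d3 j hj, hsum2 j]

/-- MaxWeight schedules push the queues towards the cone. -/
lemma IsSaturating.exists_drift {n n₁ n₂ : ℕ} {ν : Fin n → Fin n → ℝ}
    (hν : IsSaturating n n₁ n₂ ν) : ∃ δ > 0, ∀ (q : QueueState n) (s : Equiv.Perm (Fin n)),
      IsMaxWeight q s →
      inner ℝ (polarPart n n₁ n₂ (natVec q)) (toVec ν - natVec (scheduleMatrix s)) ≤
        -δ * ‖polarPart n n₁ n₂ (natVec q)‖ := by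
  obtain ⟨δ, hδ, hcap⟩ := hν.exists_perturbation
  refine ⟨δ, hδ, fun q s hs => ?_⟩
  set x := natVec q
  set p := polarPart n n₁ n₂ x with hp
  rcases eq_or_ne p 0 with h0 | h0
  · simp [h0]
  have hnorm : 0 < ‖p‖ := norm_pos_iff.2 h0
  -- The MaxWeight schedule is compared with the rates `ν + δ p / ‖p‖`.
  have hin := hs.inner_le (hcap (‖p‖⁻¹ • p)
    (smul_mem_polarCone (polarPart_mem n₁ n₂ x) (by positivity)) (by
      rw [norm_smul, norm_inv, norm_norm, inv_mul_cancel₀ hnorm.ne']))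
  have hvec : toVec (fun i j => ν i j + δ * (‖p‖⁻¹ • p : MatrixSpace n) (i, j)) =
      toVec ν + (δ * ‖p‖⁻¹) • p := by
    ext e; simp [mul_assoc]
  rw [hvec, inner_add_right, inner_smul_right, inner_polarPart_self] at hin
  -- This allows `p` to be replaced by the queue vector `x`, the one that MaxWeight controls.
  have hk : inner ℝ (x - p) (toVec ν - natVec (scheduleMatrix s)) = 0 :=
    (Submodule.mem_orthogonal' _ _).1 (sub_polarPart_mem n₁ n₂ x) _
      (sub_schedule_mem_nullSpace hν s)
  have h2 : inner ℝ p (toVec ν - natVec (scheduleMatrix s)) =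
      inner ℝ x (toVec ν) - inner ℝ x (natVec (scheduleMatrix s)) := by
    rw [inner_sub_left] at hk
    rw [← inner_sub_right]; linarith
  have h3 : δ * ‖p‖⁻¹ * ‖p‖ ^ 2 = δ * ‖p‖ := by field_simp
  rw [h2]; linarith

/-- Unused service `u` is orthogonal to `q`, and `-u` lies in the polar cone, so `⟨p, u⟩ = -⟨q - p,
u⟩ ≤ 0`. -/
lemma inner_polarPart_unusedService_nonpos {n : ℕ} (n₁ n₂ : ℕ) (q a : QueueState n)
    (s : Equiv.Perm (Fin n)) :
    inner ℝ (polarPart n n₁ n₂ (natVec q)) (natVec (unusedService q a s)) ≤ 0 := by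
  have h1 : inner ℝ (natVec q) (natVec (unusedService q a s)) = 0 := by
    rw [inner_eq_sum]
    refine Finset.sum_eq_zero fun i _ => Finset.sum_eq_zero fun j _ => ?_
    simp only [natVec_apply]
    exact_mod_cast queue_mul_unusedService q a s i j
  have h2 : -natVec (unusedService q a s) ∈ polarCone n n₁ n₂ := by
    refine ⟨fun i _ => ?_, fun j _ => ?_⟩ <;>
    · simp only [PiLp.neg_apply, natVec_apply, Finset.sum_neg_distrib, neg_nonpos]
      positivity
  have h3 := inner_sub_polarPart_nonpos (natVec q) h2
  rw [inner_neg_right, inner_sub_left, h1] at h3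
  linarith

/-- One-step bound for the squared distance to the cone, before averaging over the arrivals. -/
lemma IsSaturating.sq_norm_polarPart_nextQueue_le {n n₁ n₂ : ℕ} {ν : Fin n → Fin n → ℝ} {δ ε L : ℝ}
    (hδ : ∀ (q : QueueState n) (s : Equiv.Perm (Fin n)), IsMaxWeight q s →
      inner ℝ (polarPart n n₁ n₂ (natVec q)) (toVec ν - natVec (scheduleMatrix s)) ≤
        -δ * ‖polarPart n n₁ n₂ (natVec q)‖)
    (hε : 0 ≤ ε) (hεδ : ε * ‖toVec ν‖ ≤ δ / 2)
    {q a : QueueState n} {s : Equiv.Perm (Fin n)} (hs : IsMaxWeight q s)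
    (hL : ‖natVec a - natVec (scheduleMatrix s) + natVec (unusedService q a s)‖ ≤ L) :
    ‖polarPart n n₁ n₂ (natVec (nextQueue q a s))‖ ^ 2 ≤
      ‖polarPart n n₁ n₂ (natVec q)‖ ^ 2 +
      (2 * inner ℝ (polarPart n n₁ n₂ (natVec q)) (natVec a - (1 - ε) • toVec ν)
        - δ * ‖polarPart n n₁ n₂ (natVec q)‖ + L ^ 2) := by
  set p := polarPart n n₁ n₂ (natVec q) with hp
  set z := natVec a - natVec (scheduleMatrix s) + natVec (unusedService q a s) with hz
  have h0 : natVec (nextQueue q a s) = natVec q + z := by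
    rw [natVec_nextQueue, hz]; abel
  have h1 : ‖polarPart n n₁ n₂ (natVec (nextQueue q a s))‖ ^ 2 ≤ ‖p + z‖ ^ 2 := by
    rw [h0]; gcongr; exact norm_polarPart_add_le n₁ n₂ _ _
  have h2 : inner ℝ p z = inner ℝ p (natVec a - (1 - ε) • toVec ν) +
      inner ℝ p (toVec ν - natVec (scheduleMatrix s)) - ε * inner ℝ p (toVec ν) +
      inner ℝ p (natVec (unusedService q a s)) := by
    rw [← inner_smul_right, ← inner_add_right, ← inner_sub_right, ← inner_add_right, hz]
    congr 1; module
  have h3 := hδ q s hs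
  have h4 : inner ℝ p (natVec (unusedService q a s)) ≤ 0 :=
    inner_polarPart_unusedService_nonpos n₁ n₂ q a s
  -- The term `-ε ν` in the increment costs at most half of the drift `δ ‖p‖`; doubling the other
  -- half gives the `-δ ‖p‖` of the conclusion.
  have h5 : -(inner ℝ p (toVec ν)) ≤ ‖p‖ * ‖toVec ν‖ :=
    (neg_le_abs _).trans (abs_real_inner_le_norm _ _)
  have h6 : ε * -(inner ℝ p (toVec ν)) ≤ δ / 2 * ‖p‖ :=
    calc _ ≤ ε * (‖p‖ * ‖toVec ν‖) := by gcongr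
      _ = (ε * ‖toVec ν‖) * ‖p‖ := by ring
      _ ≤ _ := by gcongr
  have h7 : ‖z‖ ^ 2 ≤ L ^ 2 := by gcongr
  rw [norm_add_sq_real] at h1
  linarith

/-! ### The joint law of queues, schedules and arrivals -/

instance instMeasurableSpaceSchedule (n : ℕ) : MeasurableSpace (Equiv.Perm (Fin n)) := ⊤

instance instDiscreteMeasurableSpaceSchedule (n : ℕ) :
    DiscreteMeasurableSpace (Equiv.Perm (Fin n)) := ⟨fun _ => trivial⟩

instance instIsProbabilityMeasureArrivalLaw {n : ℕ} (arr : Fin n → Fin n → PMF ℕ) :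
    IsProbabilityMeasure (arrivalLaw arr) := by
  unfold arrivalLaw; infer_instance

/-- `ρ` is a joint law of queue lengths and MaxWeight schedules, for which the queue lengths have
the law `μ` both now and in the next time slot. -/
structure IsStationaryLaw {n : ℕ} (arr : Fin n → Fin n → PMF ℕ) (μ : Measure (QueueState n))
    (ρ : Measure (QueueState n × Equiv.Perm (Fin n))) : Prop where
  prob : IsProbabilityMeasure ρ
  map_fst : ρ.map Prod.fst = μ
  maxWeight : ∀ᵐ z ∂ρ, IsMaxWeight z.1 z.2
  map_next : (ρ.prod (arrivalLaw arr)).map (fun z => nextQueue z.1.1 z.2 z.1.2) = μ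

/-- Take the law of the queues followed by the rule's random schedule. Arrivals are then an
independent product factor, so pointwise one-step inequalities can be integrated on a single space.
-/
lemma exists_isStationaryLaw {n : ℕ} {arr : Fin n → Fin n → PMF ℕ}
    {rule : QueueState n → PMF (Equiv.Perm (Fin n))} (hrule : IsMaxWeightRule rule)
    {μ : Measure (QueueState n)} [IsProbabilityMeasure μ]
    (hμ : Kernel.Invariant (queueKernel arr rule) μ) :
    ∃ ρ, IsStationaryLaw arr μ ρ := by
  let κ : Kernel (QueueState n) (Equiv.Perm (Fin n)) :=
    Kernel.ofFunOfCountable fun q => (rule q).toMeasure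
  have hκ : ∀ q, κ q = (rule q).toMeasure := fun q => rfl
  have : IsMarkovKernel κ := ⟨fun q => by rw [hκ]; infer_instance⟩
  have hp : IsProbabilityMeasure (μ ⊗ₘ κ) := inferInstance
  refine ⟨μ ⊗ₘ κ, hp, Measure.fst_compProd μ κ, ?_, ?_⟩
  · refine (Measure.ae_compProd_iff (MeasurableSet.of_discrete)).2 (Eventually.of_forall fun q => ?_)
    rw [hκ, ae_iff, PMF.toMeasure_apply_eq_zero_iff _ MeasurableSet.of_discrete,
      Set.disjoint_left]
    intro s hs hs'
    exact hs' (hrule q s hs)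
  · ext t ht
    rw [Measure.map_apply Measurable.of_discrete ht, Measure.prod_apply MeasurableSet.of_discrete,
      Measure.lintegral_compProd Measurable.of_discrete]
    conv_rhs => rw [← hμ.def, Measure.bind_apply ht (Kernel.aemeasurable _)]
    refine lintegral_congr fun q => ?_
    rw [hκ, lintegral_fintype]
    have : queueKernel arr rule q =
      ∑ s : Equiv.Perm (Fin n), rule q s • (arrivalLaw arr).map (fun a => nextQueue q a s) := rfl
    rw [this, Measure.finsetSum_apply]
    refine Finset.sum_congr rfl fun s _ => ?_
    rw [PMF.toMeasure_apply_singleton _ _ MeasurableSet.of_discrete, Measure.smul_apply, smul_eq_mul,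
      Measure.map_apply Measurable.of_discrete ht, mul_comm]
    rfl

section

variable {n : ℕ} {arr : Fin n → Fin n → PMF ℕ} {μ : Measure (QueueState n)}
  {ρ : Measure (QueueState n × Equiv.Perm (Fin n))}

lemma IsStationaryLaw.map_cur (h : IsStationaryLaw arr μ ρ) :
    (ρ.prod (arrivalLaw arr)).map (fun z => z.1.1) = μ := by
  have := h.prob
  have h1 : (ρ.prod (arrivalLaw arr)).map Prod.fst = ρ := by
    rw [Measure.map_fst_prod]; simp
  conv_rhs => rw [← h.map_fst, ← h1]
  rw [Measure.map_map Measurable.of_discrete Measurable.of_discrete]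
  rfl

lemma IsStationaryLaw.integral_cur (h : IsStationaryLaw arr μ ρ) (f : QueueState n → ℝ) :
    ∫ z, f z.1.1 ∂(ρ.prod (arrivalLaw arr)) = ∫ q, f q ∂μ := by
  rw [← h.map_cur, integral_map Measurable.of_discrete.aemeasurable
    (Measurable.of_discrete.aestronglyMeasurable)]

lemma IsStationaryLaw.integral_next (h : IsStationaryLaw arr μ ρ) (f : QueueState n → ℝ) :
    ∫ z, f (nextQueue z.1.1 z.2 z.1.2) ∂(ρ.prod (arrivalLaw arr)) = ∫ q, f q ∂μ := by
  rw [← h.map_next, integral_map Measurable.of_discrete.aemeasurable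
    (Measurable.of_discrete.aestronglyMeasurable)]

lemma IsStationaryLaw.integrable_cur (h : IsStationaryLaw arr μ ρ) {f : QueueState n → ℝ}
    (hf : Integrable f μ) : Integrable (fun z => f z.1.1) (ρ.prod (arrivalLaw arr)) := by
  rw [← h.map_cur] at hf
  exact hf.comp_measurable Measurable.of_discrete

lemma IsStationaryLaw.integrable_next (h : IsStationaryLaw arr μ ρ) {f : QueueState n → ℝ}
    (hf : Integrable f μ) :
    Integrable (fun z => f (nextQueue z.1.1 z.2 z.1.2)) (ρ.prod (arrivalLaw arr)) := by
  rw [← h.map_next] at hf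
  exact hf.comp_measurable Measurable.of_discrete

lemma IsStationaryLaw.ae_maxWeight (h : IsStationaryLaw arr μ ρ) :
    ∀ᵐ z ∂(ρ.prod (arrivalLaw arr)), IsMaxWeight z.1.1 z.1.2 :=
  Measure.quasiMeasurePreserving_fst.ae h.maxWeight

/-! ### Moments of the arrivals -/

lemma measurePreserving_arrivalLaw_row (arr : Fin n → Fin n → PMF ℕ) (i : Fin n) :
    MeasurePreserving (fun a : QueueState n => a i) (arrivalLaw arr)
      (Measure.pi fun j => (arr i j).toMeasure) :=
  measurePreserving_eval (fun i => Measure.pi fun j => (arr i j).toMeasure) i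

lemma measurePreserving_arrivalLaw (arr : Fin n → Fin n → PMF ℕ) (i j : Fin n) :
    MeasurePreserving (fun a : QueueState n => a i j) (arrivalLaw arr) (arr i j).toMeasure :=
  (measurePreserving_eval (fun j => (arr i j).toMeasure) j).comp
    (measurePreserving_arrivalLaw_row arr i)

lemma integral_arrivalLaw (arr : Fin n → Fin n → PMF ℕ) (i j : Fin n) (f : ℕ → ℝ) :
    ∫ a, f (a i j) ∂(arrivalLaw arr) = ∫ k, f k ∂(arr i j).toMeasure := by
  rw [← (measurePreserving_arrivalLaw arr i j).map_eq, integral_map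
    Measurable.of_discrete.aemeasurable Measurable.of_discrete.aestronglyMeasurable]

lemma ae_arrivalLaw_le {aMax : ℕ} (harr : ∀ i j, ∀ a ∈ (arr i j).support, a ≤ aMax) :
    ∀ᵐ a ∂(arrivalLaw arr), ∀ i j, a i j ≤ aMax := by
  refine ae_all_iff.2 fun i => ae_all_iff.2 fun j => ?_
  refine (measurePreserving_arrivalLaw arr i j).quasiMeasurePreserving.ae
    (p := fun k => k ≤ aMax) ?_
  rw [ae_iff, PMF.toMeasure_apply_eq_zero_iff _ MeasurableSet.of_discrete, Set.disjoint_left]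
  intro k hk hk'
  exact hk' (harr i j k hk)

lemma indepFun_arrivalLaw_row (arr : Fin n → Fin n → PMF ℕ) {i i' : Fin n} (hi : i ≠ i') :
    IndepFun (fun a : QueueState n => a i) (fun a => a i') (arrivalLaw arr) :=
  (iIndepFun_pi (μ := fun i => Measure.pi fun j => (arr i j).toMeasure)
    (X := fun _ x => x) fun _ => aemeasurable_id).indepFun hi

/-- Distinct entries of the arrival matrix are uncorrelated. -/
lemma integral_arrivalLaw_mul (arr : Fin n → Fin n → PMF ℕ) {i j i' j' : Fin n}
    (he : (i, j) ≠ (i', j')) (f g : ℕ → ℝ) :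
    ∫ a, f (a i j) * g (a i' j') ∂(arrivalLaw arr) =
      (∫ k, f k ∂(arr i j).toMeasure) * ∫ k, g k ∂(arr i' j').toMeasure := by
  rw [← integral_arrivalLaw, ← integral_arrivalLaw]
  have hind : IndepFun (fun a : QueueState n => a i j) (fun a => a i' j') (arrivalLaw arr) := by
    -- The arrival law is a product of rows, each a product of entries: within a row the inner
    -- product gives independence, across rows the outer one.
    by_cases hi : i = i'
    · subst hi
      have hj : j ≠ j' := fun h => he (by rw [h])
      have h1 := (iIndepFun_pi (μ := fun j => (arr i j).toMeasure)
        (X := fun _ x => x) fun _ => aemeasurable_id).indepFun hj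
      rw [← (measurePreserving_arrivalLaw_row arr i).map_eq] at h1
      rw [indepFun_iff_measure_inter_preimage_eq_mul] at h1 ⊢
      intro s t hs ht
      have h2 := h1 s t hs ht
      rw [Measure.map_apply Measurable.of_discrete MeasurableSet.of_discrete,
        Measure.map_apply Measurable.of_discrete MeasurableSet.of_discrete,
        Measure.map_apply Measurable.of_discrete MeasurableSet.of_discrete] at h2
      exact h2
    · exact (indepFun_arrivalLaw_row arr hi).comp (φ := fun r => r j) (ψ := fun r => r j')
        Measurable.of_discrete Measurable.of_discrete
  exact (hind.comp (φ := f) (ψ := g) Measurable.of_discrete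
    Measurable.of_discrete).integral_fun_mul_eq_mul_integral
    Measurable.of_discrete.aestronglyMeasurable Measurable.of_discrete.aestronglyMeasurable

end

/-! ### Moment bounds -/

lemma norm_natVec_le {n : ℕ} {a : QueueState n} {b : ℕ} (h : ∀ i j, a i j ≤ b) :
    ‖natVec a‖ ≤ n * b := by
  have h1 : ‖natVec a‖ ^ 2 ≤ ((n : ℝ) * b) ^ 2 := by
    rw [EuclideanSpace.norm_sq_eq]
    have := Finset.sum_le_card_nsmul Finset.univ (fun e => ‖natVec a e‖ ^ 2) ((b : ℝ) ^ 2)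
      fun e _ => by
        rw [natVec_apply, Real.norm_natCast]
        gcongr
        exact_mod_cast h _ _
    refine this.trans (le_of_eq ?_)
    simp; ring
  exact le_of_sq_le_sq h1 (by positivity)

lemma norm_increment_le {n aMax : ℕ} {q a : QueueState n} (s : Equiv.Perm (Fin n))
    (ha : ∀ i j, a i j ≤ aMax) :
    ‖natVec a - natVec (scheduleMatrix s) + natVec (unusedService q a s)‖ ≤ n * aMax + 2 * n := by
  have h1 := norm_natVec_le ha
  have h2 := norm_natVec_le (scheduleMatrix_le_one s)
  have h3 := norm_natVec_le (unusedService_le_one q a s)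
  have h4 := norm_add_le (natVec a - natVec (scheduleMatrix s)) (natVec (unusedService q a s))
  have h5 := norm_sub_le (natVec a) (natVec (scheduleMatrix s))
  push_cast at h2 h3
  linarith

/-- Squaring a one-step bound for a squared distance. -/
lemma fourth_power_drift {d d' ξ δ M L : ℝ} (hd : 0 ≤ d) (hδ : 0 < δ) (hM : |ξ| ≤ M * d)
    (hM0 : 0 ≤ M) (h : d' ^ 2 ≤ d ^ 2 + (2 * ξ - δ * d + L ^ 2)) :
    d' ^ 4 - d ^ 4 ≤ 4 * (d ^ 2 * ξ) - δ * d ^ 3 +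
      (2 * L ^ 4 + (2 * L ^ 2 + 2 * (2 * M + δ) ^ 2) ^ 3 / δ ^ 2) := by
  set g := 2 * ξ - δ * d + L ^ 2 with hg
  set b := 2 * L ^ 2 + 2 * (2 * M + δ) ^ 2 with hb
  have hb0 : 0 ≤ b := by positivity
  have hgabs : |g| ≤ (2 * M + δ) * d + L ^ 2 := by
    rw [abs_le] at hM ⊢
    constructor <;> nlinarith [sq_nonneg L, mul_nonneg hδ.le hd]
  have hg2 : g ^ 2 ≤ 2 * (2 * M + δ) ^ 2 * d ^ 2 + 2 * L ^ 4 := by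
    have : g ^ 2 ≤ ((2 * M + δ) * d + L ^ 2) ^ 2 := sq_le_sq' (by linarith [(abs_le.1 hgabs).1])
      (abs_le.1 hgabs).2
    nlinarith [sq_nonneg ((2 * M + δ) * d - L ^ 2)]
  have h4 : d' ^ 4 ≤ (d ^ 2 + g) ^ 2 := by
    calc d' ^ 4 = (d' ^ 2) ^ 2 := by ring
      _ ≤ _ := by gcongr
  -- Here `b` collects the quadratic terms. Half of the drift `-2δd³` absorbs them when `d ≥ b / δ`;
  -- otherwise they are bounded by a constant.
  have hy : b * d ^ 2 ≤ δ * d ^ 3 + b ^ 3 / δ ^ 2 := by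
    rcases le_total b (δ * d) with hc | hc
    · have : b * d ^ 2 ≤ δ * d * d ^ 2 := by gcongr
      have h0 : 0 ≤ b ^ 3 / δ ^ 2 := by positivity
      nlinarith
    · have h1 : d ≤ b / δ := by rw [le_div_iff₀ hδ]; linarith
      have : b * d ^ 2 ≤ b * (b / δ) ^ 2 := by gcongr
      have h2 : b * (b / δ) ^ 2 = b ^ 3 / δ ^ 2 := by field_simp
      have h3 : 0 ≤ δ * d ^ 3 := by positivity
      linarith
  have hexp : (d ^ 2 + g) ^ 2 = d ^ 4 + 4 * (d ^ 2 * ξ) - 2 * δ * d ^ 3 + 2 * L ^ 2 * d ^ 2 + g ^ 2 := by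
    rw [hg]; ring
  have : b * d ^ 2 = 2 * L ^ 2 * d ^ 2 + 2 * (2 * M + δ) ^ 2 * d ^ 2 := by rw [hb]; ring
  linarith

section

variable {n : ℕ} {arr : Fin n → Fin n → PMF ℕ} {μ : Measure (QueueState n)}
  {ρ : Measure (QueueState n × Equiv.Perm (Fin n))}

/-- Arrivals are centered given the current state. -/
lemma integral_inner_centered {aMax : ℕ} [IsProbabilityMeasure ρ]
    (harr : ∀ i j, ∀ a ∈ (arr i j).support, a ≤ aMax) {lam : Fin n → Fin n → ℝ}
    (hmean : ∀ i j, ∫ a, (a : ℝ) ∂(arr i j).toMeasure = lam i j)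
    {v : QueueState n → MatrixSpace n} (hv : Integrable (fun z => ‖v z.1‖) ρ) :
    Integrable (fun z : (QueueState n × Equiv.Perm (Fin n)) × QueueState n =>
      (inner ℝ (v z.1.1) (natVec z.2 - toVec lam) : ℝ)) (ρ.prod (arrivalLaw arr)) ∧
    ∫ z, (inner ℝ (v z.1.1) (natVec z.2 - toVec lam) : ℝ) ∂(ρ.prod (arrivalLaw arr)) = 0 := by
  have hve : ∀ e, Integrable (fun z => v z.1 e) ρ := fun e =>
    hv.mono' Measurable.of_discrete.aestronglyMeasurable
      (Eventually.of_forall fun z => PiLp.norm_apply_le _ e)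
  have hae := ae_arrivalLaw_le harr
  have hai : ∀ i j, Integrable (fun a : QueueState n => (a i j : ℝ)) (arrivalLaw arr) := fun i j =>
    Integrable.of_bound Measurable.of_discrete.aestronglyMeasurable aMax (by
      filter_upwards [hae] with a ha
      rw [Real.norm_natCast]; exact_mod_cast ha i j)
  have hint : ∀ i j, Integrable (fun z : (QueueState n × Equiv.Perm (Fin n)) × QueueState n =>
      v z.1.1 (i, j) * ((z.2 i j : ℝ) - lam i j)) (ρ.prod (arrivalLaw arr)) := fun i j =>
    (hve (i, j)).mul_prod ((hai i j).sub (integrable_const _))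
  have hzero : ∀ i j, ∫ z : (QueueState n × Equiv.Perm (Fin n)) × QueueState n,
      v z.1.1 (i, j) * ((z.2 i j : ℝ) - lam i j) ∂(ρ.prod (arrivalLaw arr)) = 0 := fun i j => by
    rw [integral_prod_mul (fun z : QueueState n × Equiv.Perm (Fin n) => v z.1 (i, j))
      (fun a : QueueState n => (a i j : ℝ) - lam i j),
      integral_sub (hai i j) (integrable_const _), integral_arrivalLaw arr i j fun k => (k : ℝ), hmean]
    simp
  simp only [inner_eq_sum, PiLp.sub_apply, natVec_apply, toVec_apply]
  refine ⟨integrable_finsetSum _ fun i _ => integrable_finsetSum _ fun j _ => hint i j, ?_⟩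
  rw [integral_finsetSum _ fun i _ => integrable_finsetSum _ fun j _ => hint i j]
  refine Finset.sum_eq_zero fun i _ => ?_
  rw [integral_finsetSum _ fun j _ => hint i j]
  exact Finset.sum_eq_zero fun j _ => hzero i j

/-- Third moments of the distance to the cone, on bounded sets. -/
lemma IsStationaryLaw.integral_truncated_le {n₁ n₂ aMax : ℕ} (h : IsStationaryLaw arr μ ρ)
    (harr : ∀ i j, ∀ a ∈ (arr i j).support, a ≤ aMax)
    {ν : Fin n → Fin n → ℝ} {ε δ : ℝ} (hε : 0 ≤ ε) (hε1 : ε ≤ 1) (hδ0 : 0 < δ)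
    (hmean : ∀ i j, ∫ a, (a : ℝ) ∂(arr i j).toMeasure = (1 - ε) * ν i j)
    (hδ : ∀ (q : QueueState n) (s : Equiv.Perm (Fin n)), IsMaxWeight q s →
      inner ℝ (polarPart n n₁ n₂ (natVec q)) (toVec ν - natVec (scheduleMatrix s)) ≤
        -δ * ‖polarPart n n₁ n₂ (natVec q)‖)
    (hεδ : ε * ‖toVec ν‖ ≤ δ / 2) (k : ℕ) :
    ∫ q, {q | ‖polarPart n n₁ n₂ (natVec q)‖ ≤ k}.indicator
      (fun q => ‖polarPart n n₁ n₂ (natVec q)‖ ^ 3) q ∂μ ≤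
      (2 * (n * aMax + 2 * n : ℝ) ^ 4 + (2 * (n * aMax + 2 * n : ℝ) ^ 2 +
        2 * (2 * (n * aMax + ‖toVec ν‖) + δ) ^ 2) ^ 3 / δ ^ 2) / δ := by
  have hP := h.prob
  set d : QueueState n → ℝ := fun q => ‖polarPart n n₁ n₂ (natVec q)‖ with hd
  have hd0 : ∀ q, 0 ≤ d q := fun q => norm_nonneg _
  set L : ℝ := n * aMax + 2 * n
  set M : ℝ := n * aMax + ‖toVec ν‖
  set C₀ : ℝ := 2 * L ^ 4 + (2 * L ^ 2 + 2 * (2 * M + δ) ^ 2) ^ 3 / δ ^ 2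
  have hC₀0 : 0 ≤ C₀ := by positivity
  set P := ρ.prod (arrivalLaw arr)
  have hμP : IsProbabilityMeasure μ := by
    rw [← h.map_fst]; exact Measure.isProbabilityMeasure_map Measurable.of_discrete.aemeasurable
  set χ : QueueState n → ℝ := fun q => if d q ≤ k then 1 else 0 with hχ
  have hχ0 : ∀ q, 0 ≤ χ q := fun q => by simp only [hχ]; split_ifs <;> norm_num
  -- Being bounded, the truncated fourth power is integrable with no prior moment information, so
  -- stationarity makes its mean increment zero.
  set V : QueueState n → ℝ := fun q => min (d q ^ 4) ((k : ℝ) ^ 4) with hV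
  have hVint : Integrable V μ := Integrable.of_bound Measurable.of_discrete.aestronglyMeasurable
    ((k : ℝ) ^ 4) (Eventually.of_forall fun q => by
      rw [Real.norm_of_nonneg (le_min (by positivity) (by positivity))]
      exact min_le_right _ _)
  -- Chosen so that `⟨v q, a - λ⟩` is the linear term `d² ξ` of `fourth_power_drift`, cut off to be
  -- integrable; it has mean zero.
  set v : QueueState n → MatrixSpace n :=
    fun q => (χ q * d q ^ 2) • polarPart n n₁ n₂ (natVec q) with hv
  have hχ3 : ∀ q, χ q * d q ^ 3 ≤ (k : ℝ) ^ 3 := fun q => by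
    simp only [hχ]; split_ifs with hq
    · rw [one_mul]; have := hd0 q; gcongr
    · simp
  have hχ3int : Integrable (fun q => χ q * d q ^ 3) μ :=
    Integrable.of_bound Measurable.of_discrete.aestronglyMeasurable ((k : ℝ) ^ 3)
      (Eventually.of_forall fun q => by
        rw [Real.norm_of_nonneg (mul_nonneg (hχ0 q) (pow_nonneg (hd0 q) _))]; exact hχ3 q)
  have hvnorm : ∀ q, ‖v q‖ = χ q * d q ^ 3 := fun q => by
    rw [hv, norm_smul, Real.norm_of_nonneg (mul_nonneg (hχ0 q) (pow_nonneg (hd0 q) _))]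
    change χ q * d q ^ 2 * d q = _
    ring
  have hvint : Integrable (fun z : QueueState n × Equiv.Perm (Fin n) => ‖v z.1‖) ρ := by
    simp only [hvnorm]
    have h1 := hχ3int
    rw [← h.map_fst] at h1
    exact h1.comp_measurable Measurable.of_discrete
  obtain ⟨hci, hc0⟩ := integral_inner_centered (arr := arr) (ρ := ρ) harr
    (lam := fun i j => (1 - ε) * ν i j) hmean hvint
  have hlam : toVec (fun i j => (1 - ε) * ν i j) = (1 - ε) • toVec ν := by ext e; simp
  rw [hlam] at hci hc0
  have hpt : ∀ᵐ z ∂P, V (nextQueue z.1.1 z.2 z.1.2) - V z.1.1 ≤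
      4 * inner ℝ (v z.1.1) (natVec z.2 - (1 - ε) • toVec ν) - δ * (χ z.1.1 * d z.1.1 ^ 3) + C₀ := by
    filter_upwards [h.ae_maxWeight, Measure.quasiMeasurePreserving_snd.ae (ae_arrivalLaw_le harr)]
      with z hz ha
    obtain ⟨⟨q, s⟩, a⟩ := z
    simp only at hz ha ⊢
    by_cases hq : d q ≤ k
    · have hξ : |inner ℝ (polarPart n n₁ n₂ (natVec q)) (natVec a - (1 - ε) • toVec ν)|
          ≤ M * d q := by
        refine (abs_real_inner_le_norm _ _).trans ?_
        rw [mul_comm]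
        refine mul_le_mul_of_nonneg_right ?_ (hd0 q)
        refine (norm_sub_le _ _).trans (add_le_add (norm_natVec_le ha) ?_)
        rw [norm_smul, Real.norm_of_nonneg (by linarith)]
        exact mul_le_of_le_one_left (norm_nonneg _) (by linarith)
      have h1 := fourth_power_drift (hd0 q) hδ0 hξ (by positivity)
        (IsSaturating.sq_norm_polarPart_nextQueue_le hδ hε hεδ hz (norm_increment_le s ha))
      have h2 : V q = d q ^ 4 := min_eq_left (by have := hd0 q; gcongr)
      have h3 : V (nextQueue q a s) ≤ d (nextQueue q a s) ^ 4 := min_le_left _ _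
      have h4 : χ q = 1 := if_pos hq
      rw [h2, hv]
      simp only [h4, one_mul, inner_smul_left]
      simp only [RCLike.conj_to_real]
      linarith
    -- Beyond the truncation `V` is already at its maximum and cannot increase.
    · have h2 : V q = (k : ℝ) ^ 4 := min_eq_right (by push Not at hq; gcongr)
      have h3 : V (nextQueue q a s) ≤ (k : ℝ) ^ 4 := min_le_right _ _
      have h4 : χ q = 0 := if_neg hq
      rw [h2, hv]
      simp only [h4, zero_mul, zero_smul, inner_zero_left]
      linarith
  have hI1 : Integrable (fun z => V (nextQueue z.1.1 z.2 z.1.2) - V z.1.1) P :=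
    (h.integrable_next hVint).sub (h.integrable_cur hVint)
  have hI2 := (h.integrable_cur hχ3int).const_mul δ
  have hI3 : Integrable (fun z => 4 * inner ℝ (v z.1.1) (natVec z.2 - (1 - ε) • toVec ν) -
      δ * (χ z.1.1 * d z.1.1 ^ 3)) P := (hci.const_mul 4).sub hI2
  have hle := integral_mono_ae hI1 (hI3.add (integrable_const C₀)) hpt
  simp only [Pi.add_apply] at hle
  rw [integral_sub (h.integrable_next hVint) (h.integrable_cur hVint), h.integral_next,
    h.integral_cur, sub_self, integral_add hI3 (integrable_const C₀),
    integral_sub (hci.const_mul 4) hI2, integral_const_mul, integral_const_mul, hc0,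
    h.integral_cur (fun q => χ q * d q ^ 3)] at hle
  rw [integral_const, probReal_univ, one_smul] at hle
  have heq : ∀ q, {q | d q ≤ k}.indicator (fun q => d q ^ 3) q = χ q * d q ^ 3 := fun q => by
    simp only [hχ, Set.indicator_apply, Set.mem_ofPred_eq]
    split_ifs <;> simp
  change ∫ q, {q | d q ≤ k}.indicator (fun q => d q ^ 3) q ∂μ ≤ _
  simp only [heq]
  rw [le_div_iff₀ hδ0]
  linarith

/-- State space collapse: uniformly in the load, the third moment of the distance of the queue
lengths to the cone is bounded. -/
lemma IsSaturating.exists_moment_bound {n₁ n₂ : ℕ} {ν : Fin n → Fin n → ℝ}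
    (hν : IsSaturating n n₁ n₂ ν) (aMax : ℕ) :
    ∃ ε₀ > 0, ∃ C : ℝ, ∀ (ε : ℝ) (arr : Fin n → Fin n → PMF ℕ)
      (μ : Measure (QueueState n)) (ρ : Measure (QueueState n × Equiv.Perm (Fin n))),
      0 ≤ ε → ε ≤ ε₀ → IsStationaryLaw arr μ ρ →
      (∀ i j, ∀ a ∈ (arr i j).support, a ≤ aMax) →
      (∀ i j, ∫ a, (a : ℝ) ∂(arr i j).toMeasure = (1 - ε) * ν i j) →
      Integrable (fun q => ‖polarPart n n₁ n₂ (natVec q)‖ ^ 3) μ ∧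
      ∫ q, ‖polarPart n n₁ n₂ (natVec q)‖ ^ 3 ∂μ ≤ C := by
  obtain ⟨δ, hδ0, hδ⟩ := hν.exists_drift
  set C : ℝ := (2 * (n * aMax + 2 * n : ℝ) ^ 4 + (2 * (n * aMax + 2 * n : ℝ) ^ 2 +
        2 * (2 * (n * aMax + ‖toVec ν‖) + δ) ^ 2) ^ 3 / δ ^ 2) / δ with hC
  have hC0 : 0 ≤ C := by positivity
  -- This ensures `ε ‖ν‖ ≤ δ / 2`; the added 1 keeps the denominator positive.
  refine ⟨min 1 (δ / 2 / (‖toVec ν‖ + 1)), by positivity, C, ?_⟩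
  intro ε arr μ ρ hε hεle h harr hmean
  have hεδ : ε * ‖toVec ν‖ ≤ δ / 2 := by
    have h1 := hεle.trans (min_le_right _ _)
    rw [le_div_iff₀ (by positivity)] at h1
    nlinarith
  have hμP : IsProbabilityMeasure μ := by
    have := h.prob
    rw [← h.map_fst]; exact Measure.isProbabilityMeasure_map Measurable.of_discrete.aemeasurable
  have hk := h.integral_truncated_le harr hε (hεle.trans (min_le_left _ _)) hδ0 hmean hδ hεδ
  rw [← hC] at hk
  set d : QueueState n → ℝ := fun q => ‖polarPart n n₁ n₂ (natVec q)‖ with hd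
  have hd0 : ∀ q, 0 ≤ d q := fun q => norm_nonneg _
  set f : ℕ → QueueState n → ℝ := fun k => {q | d q ≤ k}.indicator (fun q => d q ^ 3) with hf
  have hf0 : ∀ k q, 0 ≤ f k q := fun k q =>
    Set.indicator_nonneg (fun q _ => pow_nonneg (hd0 q) 3) q
  have hfint : ∀ k, Integrable (f k) μ := fun k =>
    Integrable.of_bound Measurable.of_discrete.aestronglyMeasurable ((k : ℝ) ^ 3)
      (Eventually.of_forall fun q => by
        rw [Real.norm_of_nonneg (hf0 k q)]
        simp only [hf, Set.indicator_apply, Set.mem_ofPred_eq]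
        split_ifs with hq
        · have := hd0 q; gcongr
        · positivity)
  -- The truncated bound does not depend on `k`, so monotone convergence removes the truncation and
  -- yields integrability too.
  have hlim : Tendsto (fun k => ∫⁻ q, ENNReal.ofReal (f k q) ∂μ) atTop
      (𝓝 (∫⁻ q, ENNReal.ofReal (d q ^ 3) ∂μ)) := by
    refine lintegral_tendsto_of_tendsto_of_monotone
      (fun k => Measurable.of_discrete.aemeasurable) (Eventually.of_forall fun q k l hkl => ?_)
      (Eventually.of_forall fun q => ?_)
    · refine ENNReal.ofReal_le_ofReal ?_
      refine Set.indicator_le_indicator_of_subset (fun q hq => ?_)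
        (fun q => pow_nonneg (hd0 q) 3) q
      have hq : d q ≤ k := hq
      exact hq.trans (by exact_mod_cast hkl)
    · refine tendsto_const_nhds.congr' ?_
      filter_upwards [eventually_ge_atTop ⌈d q⌉₊] with k hk'
      have hq : d q ≤ k := Nat.ceil_le.1 hk'
      simp [hf, hq]
  have hlint : ∫⁻ q, ENNReal.ofReal (d q ^ 3) ∂μ ≤ ENNReal.ofReal C := by
    refine le_of_tendsto' hlim fun k => ?_
    rw [← ofReal_integral_eq_lintegral_ofReal (hfint k) (Eventually.of_forall (hf0 k))]
    exact ENNReal.ofReal_le_ofReal (hk k)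
  have hint : Integrable (fun q => d q ^ 3) μ := by
    refine ⟨Measurable.of_discrete.aestronglyMeasurable, ?_⟩
    rw [hasFiniteIntegral_iff_ofReal (Eventually.of_forall fun q => pow_nonneg (hd0 q) 3)]
    exact hlint.trans_lt ENNReal.ofReal_lt_top
  refine ⟨hint, ?_⟩
  rw [← ofReal_integral_eq_lintegral_ofReal hint
    (Eventually.of_forall fun q => pow_nonneg (hd0 q) 3)] at hlint
  exact (ENNReal.ofReal_le_ofReal_iff hC0).1 hlint

end

/-! ### The space of port weights -/

/-- The unit matrix at such an entry touches no saturated port, so it lies in `nullSpace`. -/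
lemma apply_eq_zero_of_mem_portSpace {n n₁ n₂ : ℕ} {y : MatrixSpace n} (hy : y ∈ portSpace n n₁ n₂)
    {i j : Fin n} (hi : n₁ ≤ (i : ℕ)) (hj : n₂ ≤ (j : ℕ)) : y (i, j) = 0 := by
  have hmem : EuclideanSpace.single (i, j) (1 : ℝ) ∈ nullSpace n n₁ n₂ := by
    refine ⟨fun k hk => Finset.sum_eq_zero fun l _ => ?_, fun l hl => Finset.sum_eq_zero fun k _ => ?_⟩
    · have : (k, l) ≠ (i, j) := by rintro ⟨⟩; omega
      simp [this]
    · have : (k, l) ≠ (i, j) := by rintro ⟨⟩; omega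
      simp [this]
  have := (Submodule.mem_orthogonal' _ _).1 hy _ hmem
  simpa [EuclideanSpace.inner_single_right] using this

/-- The all-ones matrix. -/
noncomputable def onesVec (n : ℕ) : MatrixSpace n := toVec fun _ _ => 1

lemma inner_onesVec {n : ℕ} (x : MatrixSpace n) : inner ℝ x (onesVec n) = ∑ i, ∑ j, x (i, j) := by
  simp [inner_eq_sum, onesVec]

lemma norm_onesVec (n : ℕ) : ‖onesVec n‖ = n := by
  have : ‖onesVec n‖ ^ 2 = (n : ℝ) ^ 2 := by
    rw [← real_inner_self_eq_norm_sq, inner_onesVec]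
    simp [onesVec, pow_two]
  exact (sq_eq_sq₀ (norm_nonneg _) (by positivity)).1 this

/-- `ν` and the matrix with all entries `1 / n` have equal saturated sums. This turns the pairing
with `ν` in the drift identity into a total queue length. -/
lemma IsSaturating.inner_eq {n n₁ n₂ : ℕ} {ν : Fin n → Fin n → ℝ} (hν : IsSaturating n n₁ n₂ ν)
    (hn : 0 < n) {y : MatrixSpace n} (hy : y ∈ portSpace n n₁ n₂) :
    inner ℝ y (toVec ν) = inner ℝ y (onesVec n) / n := by
  have hn' : (n : ℝ) ≠ 0 := by positivity
  have hmem : toVec ν - (n : ℝ)⁻¹ • onesVec n ∈ nullSpace n n₁ n₂ := by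
    refine ⟨fun i hi => ?_, fun j hj => ?_⟩
    · simp [Finset.sum_sub_distrib, hν.row_eq i hi, onesVec, hn']
    · simp [Finset.sum_sub_distrib, hν.col_eq j hj, onesVec, hn']
  have := (Submodule.mem_orthogonal' _ _).1 hy _ hmem
  rw [inner_sub_right, inner_smul_right] at this
  rw [div_eq_inv_mul]; linarith

lemma IsSaturating.inner_sub_schedule {n n₁ n₂ : ℕ} {ν : Fin n → Fin n → ℝ}
    (hν : IsSaturating n n₁ n₂ ν) (s : Equiv.Perm (Fin n)) {y : MatrixSpace n}
    (hy : y ∈ portSpace n n₁ n₂) : inner ℝ y (natVec (scheduleMatrix s)) = inner ℝ y (toVec ν) := by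
  have := (Submodule.mem_orthogonal' _ _).1 hy _ (sub_schedule_mem_nullSpace hν s)
  rw [inner_sub_right] at this
  linarith

/-- The number of saturated ports to which each queue belongs. -/
noncomputable def portVec (n n₁ n₂ : ℕ) : MatrixSpace n :=
  toVec fun i j => (if (i : ℕ) < n₁ then 1 else 0) + (if (j : ℕ) < n₂ then 1 else 0)

/-- Matrices `wᵢ + w'ⱼ` belong to the space of port weights. -/
lemma add_mem_portSpace {n n₁ n₂ : ℕ} {w v : Fin n → ℝ} (hw : ∀ i : Fin n, n₁ ≤ (i : ℕ) → w i = 0)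
    (hv : ∀ j : Fin n, n₂ ≤ (j : ℕ) → v j = 0) :
    toVec (fun i j => w i + v j) ∈ portSpace n n₁ n₂ := by
  rw [portSpace, Submodule.mem_orthogonal']
  intro z hz
  simp only [inner_eq_sum, toVec_apply, add_mul, Finset.sum_add_distrib]
  rw [Finset.sum_comm (f := fun i j => v j * z (i, j))]
  simp only [← Finset.mul_sum]
  rw [Finset.sum_eq_zero, Finset.sum_eq_zero, add_zero]
  · intro j _
    rcases lt_or_ge (j : ℕ) n₂ with h | h
    · rw [hz.2 j h, mul_zero]
    · rw [hv j h, zero_mul]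
  · intro i _
    rcases lt_or_ge (i : ℕ) n₁ with h | h
    · rw [hz.1 i h, mul_zero]
    · rw [hw i h, zero_mul]

lemma portVec_mem (n n₁ n₂ : ℕ) : portVec n n₁ n₂ ∈ portSpace n n₁ n₂ :=
  add_mem_portSpace (fun i hi => if_neg (by omega)) (fun j hj => if_neg (by omega))

lemma sum_ite_lt {n m : ℕ} (hm : m ≤ n) : ∑ i : Fin n, (if (i : ℕ) < m then (1 : ℝ) else 0) = m := by
  rw [Fin.sum_univ_eq_sum_range (fun i => if i < m then (1 : ℝ) else 0), Finset.sum_ite,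
    Finset.sum_const_zero, add_zero, Finset.sum_const, nsmul_one]
  congr 1
  have : (Finset.range n).filter (fun x => x < m) = Finset.range m := by
    ext x; simp; omega
  rw [this, Finset.card_range]

/-- The diagonal entries of the projection to the space of port weights. -/
lemma starProjection_portSpace_diag {n n₁ n₂ : ℕ} (hn₁ : n₁ < n) (hn₂ : n₂ < n) (i j : Fin n) :
    n * (portSpace n n₁ n₂).starProjection (EuclideanSpace.single (i, j) 1) (i, j) =
      zetaWeight n n₁ n₂ i j := by
  have hn : (0 : ℝ) < n := by exact_mod_cast (Nat.zero_le _).trans_lt hn₁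
  have h1 : (n₁ : ℝ) < n := by exact_mod_cast hn₁
  have h2 : (n₂ : ℝ) < n := by exact_mod_cast hn₂
  have hD : (0 : ℝ) < (n : ℝ) ^ 2 - n₁ * n₂ := by
    nlinarith [(Nat.cast_nonneg n₁ : (0 : ℝ) ≤ n₁), (Nat.cast_nonneg n₂ : (0 : ℝ) ≤ n₂)]
  set D : ℝ := (n : ℝ) ^ 2 - n₁ * n₂ with hDdef
  set α : Fin n → ℝ := fun k => if (k : ℕ) < n₁ then 1 else 0 with hα
  set β : Fin n → ℝ := fun k => if (k : ℕ) < n₂ then 1 else 0 with hβ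
  have hαs : ∑ k, α k = n₁ := sum_ite_lt hn₁.le
  have hβs : ∑ k, β k = n₂ := sum_ite_lt hn₂.le
  -- The residual must have zero saturated sums: `n w k + V = [k = i]` and `n v l + W = [l = j]`,
  -- where `W = ∑ w` and `V = ∑ v`. Summing gives `n W + n₁ V = α i` and `n V + n₂ W = β j`, of
  -- determinant `D`.
  set W : ℝ := (n * α i - n₁ * β j) / D with hW
  set V : ℝ := (n * β j - n₂ * α i) / D with hV
  set w : Fin n → ℝ := fun k => α k * ((if k = i then 1 else 0) - V) / n with hw
  set v : Fin n → ℝ := fun k => β k * ((if k = j then 1 else 0) - W) / n with hv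
  have hws : ∑ k, w k = W := by
    simp only [hw, ← Finset.sum_div, mul_sub, Finset.sum_sub_distrib, ← Finset.sum_mul, hαs]
    simp only [mul_ite, mul_one, mul_zero, Finset.sum_ite_eq', Finset.mem_univ, if_true]
    rw [hV, hW]; field_simp; rw [hDdef]; ring
  have hvs : ∑ k, v k = V := by
    simp only [hv, ← Finset.sum_div, mul_sub, Finset.sum_sub_distrib, ← Finset.sum_mul, hβs]
    simp only [mul_ite, mul_one, mul_zero, Finset.sum_ite_eq', Finset.mem_univ, if_true]
    rw [hV, hW]; field_simp; rw [hDdef]; ring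
  have hproj : (portSpace n n₁ n₂).starProjection (EuclideanSpace.single (i, j) 1) =
      toVec fun k l => w k + v l := by
    refine Submodule.eq_starProjection_of_mem_orthogonal
      (add_mem_portSpace (fun k hk => ?_) (fun k hk => ?_)) ?_
    · simp only [hw, hα, if_neg (not_lt.2 hk)]; simp
    · simp only [hv, hβ, if_neg (not_lt.2 hk)]; simp
    · refine Submodule.le_orthogonal_orthogonal (nullSpace n n₁ n₂) ⟨fun k hk => ?_, fun l hl => ?_⟩
      · have hs : ∑ l, (EuclideanSpace.single (i, j) (1 : ℝ)) (k, l) = if k = i then 1 else 0 := by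
          by_cases h : k = i <;> simp [PiLp.single_apply, h]
        simp only [PiLp.sub_apply, toVec_apply, Finset.sum_sub_distrib, Finset.sum_add_distrib, hs,
          hvs, Finset.sum_const, Finset.card_univ, Fintype.card_fin, nsmul_eq_mul]
        simp only [hw, hα, if_pos hk]
        field_simp; ring
      · have hs : ∑ k, (EuclideanSpace.single (i, j) (1 : ℝ)) (k, l) = if l = j then 1 else 0 := by
          by_cases h : l = j <;> simp [PiLp.single_apply, h]
        simp only [PiLp.sub_apply, toVec_apply, Finset.sum_sub_distrib, Finset.sum_add_distrib, hs,
          hws, Finset.sum_const, Finset.card_univ, Fintype.card_fin, nsmul_eq_mul]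
        simp only [hv, hβ, if_pos hl]
        field_simp; ring
  rw [hproj, toVec_apply]
  simp only [hw, hv, hV, hW, zetaWeight, if_true]
  have hα' : α i = if (i : ℕ) < n₁ then 1 else 0 := rfl
  have hβ' : β j = if (j : ℕ) < n₂ then 1 else 0 := rfl
  rw [hα', hβ', ← hDdef]
  split_ifs <;> field_simp <;> ring

/-- Saturated queues at which service is wasted control pairings with port weights. -/
lemma abs_inner_le_of_mem_portSpace {n n₁ n₂ : ℕ} {y u : MatrixSpace n}
    (hy : y ∈ portSpace n n₁ n₂) {b : ℝ} (hb : 0 ≤ b) (hu : ∀ e, 0 ≤ u e)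
    (h : ∀ e, |y e * u e| ≤ b * u e) :
    |inner ℝ y u| ≤ b * inner ℝ (portVec n n₁ n₂) u := by
  simp only [inner_eq_sum, Finset.mul_sum]
  refine (Finset.abs_sum_le_sum_abs _ _).trans (Finset.sum_le_sum fun i _ => ?_)
  refine (Finset.abs_sum_le_sum_abs _ _).trans (Finset.sum_le_sum fun j _ => ?_)
  have hbu := mul_nonneg hb (hu (i, j))
  have := h (i, j)
  simp only [portVec, toVec_apply]
  rcases lt_or_ge (i : ℕ) n₁ with hi | hi
  · rw [if_pos hi]; split_ifs <;> nlinarith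
  · rcases lt_or_ge (j : ℕ) n₂ with hj | hj
    · rw [if_pos hj]; split_ifs <;> nlinarith
    · rw [apply_eq_zero_of_mem_portSpace hy hi hj]
      simp [not_lt.2 hi, not_lt.2 hj]

/-! ### Unused service paired with port weights. -/

section

variable {n n₁ n₂ : ℕ}

lemma inner_portVec_unusedService_nonneg (q a : QueueState n) (s : Equiv.Perm (Fin n)) :
    0 ≤ (inner ℝ (portVec n n₁ n₂) (natVec (unusedService q a s)) : ℝ) := by
  rw [inner_eq_sum]
  refine Finset.sum_nonneg fun i _ => Finset.sum_nonneg fun j _ => ?_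
  simp only [portVec, toVec_apply, natVec_apply]
  split_ifs <;> positivity

lemma inner_portVec_unusedService_le (q a : QueueState n) (s : Equiv.Perm (Fin n)) :
    (inner ℝ (portVec n n₁ n₂) (natVec (unusedService q a s)) : ℝ) ≤ 2 * (n : ℝ) ^ 2 := by
  rw [inner_eq_sum]
  have h : ∀ i j : Fin n, portVec n n₁ n₂ (i, j) * natVec (unusedService q a s) (i, j) ≤ 2 := by
    intro i j
    have h1 : (unusedService q a s i j : ℝ) ≤ 1 := by exact_mod_cast unusedService_le_one q a s i j
    have h0 : (0 : ℝ) ≤ unusedService q a s i j := by positivity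
    simp only [portVec, toVec_apply, natVec_apply]
    split_ifs <;> linarith
  calc _ ≤ ∑ _i : Fin n, ∑ _j : Fin n, (2 : ℝ) :=
        Finset.sum_le_sum fun i _ => Finset.sum_le_sum fun j _ => h i j
    _ = _ := by simp; ring

/-- The pairing of unused service with the port weights of the next state is small. -/
lemma abs_inner_nextQueue_unusedService_le (q a : QueueState n) (s : Equiv.Perm (Fin n)) :
    |inner ℝ ((portSpace n n₁ n₂).starProjection (natVec (nextQueue q a s)))
      (natVec (unusedService q a s))| ≤
      ‖polarPart n n₁ n₂ (natVec (nextQueue q a s))‖ *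
        inner ℝ (portVec n n₁ n₂) (natVec (unusedService q a s)) := by
  refine abs_inner_le_of_mem_portSpace (Submodule.starProjection_apply_mem _ _) (norm_nonneg _)
    (fun e => by simp) fun e => ?_
  set x := natVec (nextQueue q a s)
  have h0 : x e * natVec (unusedService q a s) e = 0 := by
    simp only [x, natVec_apply]
    exact_mod_cast nextQueue_mul_unusedService q a s e.1 e.2
  -- Where service is wasted the next queue is zero, so the entry of its projection is minus the
  -- entry of the collapse error.
  have h1 : (portSpace n n₁ n₂).starProjection x e * natVec (unusedService q a s) e =
      -((x - (portSpace n n₁ n₂).starProjection x) e * natVec (unusedService q a s) e) := by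
    rw [PiLp.sub_apply, sub_mul, h0]; ring
  have hu : 0 ≤ natVec (unusedService q a s) e := by simp
  rw [h1, abs_neg, abs_mul, abs_of_nonneg hu]
  gcongr
  exact (PiLp.norm_apply_le (x - (portSpace n n₁ n₂).starProjection x) e).trans
    (norm_sub_starProjection_le n₁ n₂ x)

/-- `‖T u‖² = ⟨T u, u⟩`, and the entries of `T u` are at most `‖u‖ ≤ n`. The bound is linear in the
unused service at saturated ports, hence of order `ε` in mean. -/
lemma sq_norm_starProjection_unusedService_le (q a : QueueState n) (s : Equiv.Perm (Fin n)) :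
    ‖(portSpace n n₁ n₂).starProjection (natVec (unusedService q a s))‖ ^ 2 ≤
      n * inner ℝ (portVec n n₁ n₂) (natVec (unusedService q a s)) := by
  set u := natVec (unusedService q a s) with hudef
  set T := (portSpace n n₁ n₂).starProjection
  have hT : T u ∈ portSpace n n₁ n₂ := Submodule.starProjection_apply_mem _ _
  have h1 : ‖T u‖ ^ 2 = inner ℝ (T u) u := by
    rw [← real_inner_self_eq_norm_sq, Submodule.inner_starProjection_left_eq_right,
      Submodule.starProjection_eq_self_iff.2 hT, real_inner_comm]
  have hu : ∀ e, 0 ≤ u e := fun e => by simp [hudef]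
  rw [h1]
  refine (le_abs_self _).trans (abs_inner_le_of_mem_portSpace hT (by positivity) hu fun e => ?_)
  rw [abs_mul, abs_of_nonneg (hu e)]
  refine mul_le_mul_of_nonneg_right ?_ (hu e)
  refine (PiLp.norm_apply_le (T u) e).trans (((portSpace n n₁ n₂).norm_starProjection_apply_le u).trans ?_)
  simpa using norm_natVec_le (unusedService_le_one q a s)

end

/-! ### The quadratic drift identity -/

section

variable {n n₁ n₂ : ℕ}

lemma norm_polarPart_le (n₁ n₂ : ℕ) (x : MatrixSpace n) : ‖polarPart n n₁ n₂ x‖ ≤ ‖x‖ := by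
  have h1 := inner_polarPart_self n₁ n₂ x
  have h2 := real_inner_le_norm x (polarPart n n₁ n₂ x)
  rcases eq_or_lt_of_le (norm_nonneg (polarPart n n₁ n₂ x)) with h | h
  · rw [← h]; positivity
  · nlinarith

/-- With no saturated ports the polar cone is the whole space, so moment bounds for the distance
become moment bounds for the queues themselves. -/
lemma polarPart_zero_zero (x : MatrixSpace n) : polarPart n 0 0 x = x := by
  have h := inner_sub_polarPart_nonpos (n₁ := 0) (n₂ := 0) x (y := x - polarPart n 0 0 x)
    ⟨fun i hi => absurd hi (Nat.not_lt_zero _), fun j hj => absurd hj (Nat.not_lt_zero _)⟩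
  rw [real_inner_self_nonpos, sub_eq_zero] at h
  exact h.symm

lemma IsSaturating.scale {ν : Fin n → Fin n → ℝ} (hν : IsSaturating n n₁ n₂ ν) {ε : ℝ}
    (h0 : 0 < ε) (h1 : ε < 1) : IsSaturating n 0 0 fun i j => (1 - ε) * ν i j := by
  have hr : ∀ i, ∑ j, ν i j ≤ 1 := fun i => (lt_or_ge (i : ℕ) n₁).elim
    (fun h => (hν.row_eq i h).le) fun h => (hν.row_lt i h).le
  have hc : ∀ j, ∑ i, ν i j ≤ 1 := fun j => (lt_or_ge (j : ℕ) n₂).elim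
    (fun h => (hν.col_eq j h).le) fun h => (hν.col_lt j h).le
  refine ⟨fun i j => mul_pos (by linarith) (hν.pos i j), fun i hi => absurd hi (Nat.not_lt_zero _),
    fun j hj => absurd hj (Nat.not_lt_zero _), fun i _ => ?_, fun j _ => ?_⟩
  · rw [← Finset.mul_sum]; nlinarith [hr i]
  · rw [← Finset.mul_sum]; nlinarith [hc j]

/-- Since `T s = T ν`, one has `T q' = T q + T (a - λ) - ε T ν + T u`, with `q'` the next state and
`u` the unused service. The left side is `‖T q'‖² - ‖T q' - T u‖²`, and expanding the second square
gives the rest. -/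
lemma IsSaturating.drift_identity {ν : Fin n → Fin n → ℝ} (hν : IsSaturating n n₁ n₂ ν) (ε : ℝ)
    (q a : QueueState n) (s : Equiv.Perm (Fin n)) {T : MatrixSpace n →L[ℝ] MatrixSpace n}
    (hT : T = (portSpace n n₁ n₂).starProjection) :
    2 * inner ℝ (T (natVec (nextQueue q a s))) (natVec (unusedService q a s)) -
        ‖T (natVec (unusedService q a s))‖ ^ 2 =
      ‖T (natVec (nextQueue q a s))‖ ^ 2 - ‖T (natVec q)‖ ^ 2
        - 2 * inner ℝ (T (natVec q)) (natVec a - (1 - ε) • toVec ν)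
        + 2 * ε * inner ℝ (T (natVec q)) (toVec ν)
        - ‖T (natVec a - (1 - ε) • toVec ν)‖ ^ 2
        + 2 * ε * inner ℝ (T (toVec ν)) (natVec a - (1 - ε) • toVec ν)
        - ε ^ 2 * ‖T (toVec ν)‖ ^ 2 := by
  have hin : ∀ x y, inner ℝ (T x) y = inner ℝ (T x) (T y) := by
    intro x y
    rw [hT, ← Submodule.inner_starProjection_left_eq_right,
      Submodule.starProjection_eq_self_iff.2 (Submodule.starProjection_apply_mem _ _)]
  have hs : T (natVec (scheduleMatrix s)) = T (toVec ν) := by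
    have h1 : T (toVec ν - natVec (scheduleMatrix s)) = 0 := by
      rw [hT, portSpace, Submodule.starProjection_apply_eq_zero_iff]
      exact Submodule.le_orthogonal_orthogonal _ (sub_schedule_mem_nullSpace hν s)
    rw [map_sub, sub_eq_zero] at h1
    exact h1.symm
  have hnext : T (natVec (nextQueue q a s)) = T (natVec q) + T (natVec a - (1 - ε) • toVec ν)
      - ε • T (toVec ν) + T (natVec (unusedService q a s)) := by
    rw [natVec_nextQueue]
    simp only [map_add, map_sub, map_smul, hs]
    module
  rw [hin _ (natVec (unusedService q a s)), hin _ (natVec a - (1 - ε) • toVec ν),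
    hin _ (toVec ν), hin (toVec ν) (natVec a - (1 - ε) • toVec ν), hnext]
  generalize T (natVec q) = b
  generalize T (natVec a - (1 - ε) • toVec ν) = c
  generalize T (toVec ν) = f
  generalize T (natVec (unusedService q a s)) = g
  simp only [← real_inner_self_eq_norm_sq, inner_add_left, inner_add_right, inner_sub_left,
    inner_sub_right, inner_smul_left, inner_smul_right, RCLike.conj_to_real]
  rw [real_inner_comm c b, real_inner_comm f b, real_inner_comm g b, real_inner_comm f c,
    real_inner_comm g c, real_inner_comm g f]
  ring

variable {arr : Fin n → Fin n → PMF ℕ} {μ : Measure (QueueState n)}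
  {ρ : Measure (QueueState n × Equiv.Perm (Fin n))}

/-- The variance of the arrivals in the directions of the port weights. -/
lemma integral_sq_norm_starProjection_arrivals (n₁ n₂ : ℕ) {aMax : ℕ}
    (harr : ∀ i j, ∀ a ∈ (arr i j).support, a ≤ aMax) {lam : Fin n → Fin n → ℝ}
    (hmean : ∀ i j, ∫ a, (a : ℝ) ∂(arr i j).toMeasure = lam i j) :
    Integrable (fun a => ‖(portSpace n n₁ n₂).starProjection (natVec a - toVec lam)‖ ^ 2)
      (arrivalLaw arr) ∧
    ∫ a, ‖(portSpace n n₁ n₂).starProjection (natVec a - toVec lam)‖ ^ 2 ∂(arrivalLaw arr) =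
      ∑ i, ∑ j, (portSpace n n₁ n₂).starProjection (EuclideanSpace.single (i, j) 1) (i, j) *
        variance (fun a : ℕ => (a : ℝ)) (arr i j).toMeasure := by
  have hae := ae_arrivalLaw_le harr
  set T := (portSpace n n₁ n₂).starProjection with hT
  have hexp : ∀ z : MatrixSpace n, ‖T z‖ ^ 2 =
      ∑ e, ∑ f, T (EuclideanSpace.single e 1) f * (z e * z f) := by
    intro z
    have h1 : ∀ e, T z e = ∑ f, T (EuclideanSpace.single e 1) f * z f := by
      intro e
      have h2 : T z e = inner ℝ z (T (EuclideanSpace.single e 1)) := by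
        rw [hT, ← Submodule.inner_starProjection_left_eq_right]
        simp [EuclideanSpace.inner_single_right]
      rw [h2, PiLp.inner_apply]
      simp
    have h3 : ‖T z‖ ^ 2 = inner ℝ z (T z) := by
      rw [← real_inner_self_eq_norm_sq, hT, Submodule.inner_starProjection_left_eq_right,
        Submodule.starProjection_eq_self_iff.2 (Submodule.starProjection_apply_mem _ _)]
    rw [h3, PiLp.inner_apply]
    refine Finset.sum_congr rfl fun e _ => ?_
    simp only [h1, RCLike.inner_apply, RCLike.conj_to_real, Finset.sum_mul]
    exact Finset.sum_congr rfl fun f _ => by ring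
  simp only [hexp]
  have hzb : ∀ e : Fin n × Fin n, ∀ᵐ a ∂(arrivalLaw arr),
      |(natVec a - toVec lam) e| ≤ aMax + |lam e.1 e.2| := by
    intro e
    filter_upwards [hae] with a ha
    rw [PiLp.sub_apply, natVec_apply, toVec_apply]
    refine (abs_sub _ _).trans (add_le_add ?_ le_rfl)
    rw [Nat.abs_cast]
    exact_mod_cast ha _ _
  have hint : ∀ e f : Fin n × Fin n, Integrable (fun a => T (EuclideanSpace.single e 1) f *
      ((natVec a - toVec lam) e * (natVec a - toVec lam) f)) (arrivalLaw arr) := by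
    intro e f
    refine Integrable.const_mul (Integrable.of_bound Measurable.of_discrete.aestronglyMeasurable
      ((aMax + |lam e.1 e.2|) * (aMax + |lam f.1 f.2|)) ?_) _
    filter_upwards [hzb e, hzb f] with a h1 h2
    rw [Real.norm_eq_abs, abs_mul]
    gcongr
  refine ⟨integrable_finsetSum _ fun e _ => integrable_finsetSum _ fun f _ => hint e f, ?_⟩
  rw [integral_finsetSum _ fun e _ => integrable_finsetSum _ fun f _ => hint e f,
    Fintype.sum_prod_type]
  refine Finset.sum_congr rfl fun i _ => Finset.sum_congr rfl fun j _ => ?_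
  rw [integral_finsetSum _ fun f _ => hint (i, j) f]
  rw [Finset.sum_eq_single (i, j)]
  · rw [integral_const_mul, variance_eq_integral Measurable.of_discrete.aemeasurable, hmean,
      ← integral_arrivalLaw arr i j fun k => ((k : ℝ) - lam i j) ^ 2]
    simp only [PiLp.sub_apply, natVec_apply, toVec_apply, pow_two]
  · rintro ⟨k, l⟩ - hne
    have hci : Integrable (fun a : ℕ => (a : ℝ)) (arr i j).toMeasure := by
      have h := (measurePreserving_arrivalLaw arr i j).map_eq
      rw [← h, integrable_map_measure Measurable.of_discrete.aestronglyMeasurable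
        Measurable.of_discrete.aemeasurable]
      refine Integrable.of_bound Measurable.of_discrete.aestronglyMeasurable aMax ?_
      filter_upwards [hae] with a ha
      rw [Function.comp_apply, Real.norm_natCast]
      exact_mod_cast ha i j
    rw [integral_const_mul]
    simp only [PiLp.sub_apply, natVec_apply, toVec_apply]
    rw [integral_arrivalLaw_mul arr hne.symm (fun x => (x : ℝ) - lam i j)
      (fun x => (x : ℝ) - lam k l), integral_sub hci (integrable_const _), hmean]
    simp
  · simp

lemma integrable_of_cubic_bound [IsFiniteMeasure μ]
    (hmom : Integrable (fun q => ‖natVec q‖ ^ 3) μ) {f : QueueState n → ℝ} (c : ℝ)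
    (hf : ∀ q, |f q| ≤ c * (1 + ‖natVec q‖ ^ 3)) : Integrable f μ :=
  (((integrable_const 1).add hmom).const_mul c).mono' Measurable.of_discrete.aestronglyMeasurable
    (Eventually.of_forall hf)

lemma le_one_add_cube {t : ℝ} (ht : 0 ≤ t) : t ≤ 1 + t ^ 3 := by
  nlinarith [sq_nonneg (t - 1), mul_nonneg ht (sq_nonneg (t - 1))]

lemma sq_le_one_add_cube {t : ℝ} (ht : 0 ≤ t) : t ^ 2 ≤ 1 + t ^ 3 := by
  nlinarith [sq_nonneg (t - 1), mul_nonneg ht (sq_nonneg (t - 1))]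

/-- The mean amount of unused service at saturated ports. -/
lemma IsStationaryLaw.integral_unusedService (h : IsStationaryLaw arr μ ρ) {aMax : ℕ}
    (harr : ∀ i j, ∀ a ∈ (arr i j).support, a ≤ aMax)
    {ν : Fin n → Fin n → ℝ} (hν : IsSaturating n n₁ n₂ ν) {ε : ℝ}
    (hmean : ∀ i j, ∫ a, (a : ℝ) ∂(arr i j).toMeasure = (1 - ε) * ν i j)
    (hmom : Integrable (fun q => ‖natVec q‖ ^ 3) μ) :
    Integrable (fun z : (QueueState n × Equiv.Perm (Fin n)) × QueueState n =>
      (inner ℝ (portVec n n₁ n₂) (natVec (unusedService z.1.1 z.2 z.1.2)) : ℝ))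
      (ρ.prod (arrivalLaw arr)) ∧
    ∫ z, (inner ℝ (portVec n n₁ n₂) (natVec (unusedService z.1.1 z.2 z.1.2)) : ℝ)
      ∂(ρ.prod (arrivalLaw arr)) = ε * inner ℝ (portVec n n₁ n₂) (toVec ν) := by
  have hP := h.prob
  have hμP : IsProbabilityMeasure μ := by
    rw [← h.map_fst]; exact Measure.isProbabilityMeasure_map Measurable.of_discrete.aemeasurable
  set g := portVec n n₁ n₂ with hg
  have hlam : toVec (fun i j => (1 - ε) * ν i j) = (1 - ε) • toVec ν := by ext e; simp
  obtain ⟨hci, hc0⟩ := integral_inner_centered (arr := arr) (ρ := ρ) harr hmean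
    (v := fun _ => g) (integrable_const _)
  rw [hlam] at hci hc0
  have hgq : Integrable (fun q => (inner ℝ g (natVec q) : ℝ)) μ :=
    integrable_of_cubic_bound hmom ‖g‖ fun q => (abs_real_inner_le_norm _ _).trans
      (mul_le_mul_of_nonneg_left (le_one_add_cube (norm_nonneg _)) (norm_nonneg _))
  -- Schedules and `ν` pair equally with the port vector. In mean the queue terms cancel by
  -- stationarity and the centered arrivals vanish, leaving the deficit `ε ⟨g, ν⟩`.
  have hpt : ∀ z : (QueueState n × Equiv.Perm (Fin n)) × QueueState n,
      (inner ℝ g (natVec (unusedService z.1.1 z.2 z.1.2)) : ℝ) =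
      inner ℝ g (natVec (nextQueue z.1.1 z.2 z.1.2)) - inner ℝ g (natVec z.1.1)
        - inner ℝ g (natVec z.2 - (1 - ε) • toVec ν) + ε * inner ℝ g (toVec ν) := by
    intro z
    have h1 := hν.inner_sub_schedule z.1.2 (portVec_mem n n₁ n₂)
    rw [natVec_nextQueue, inner_add_right, inner_sub_right, inner_add_right, inner_sub_right,
      inner_smul_right, h1, ← hg]
    ring
  have i1 := h.integrable_next hgq
  have i2 := h.integrable_cur hgq
  have i3 : Integrable (fun z => (inner ℝ g (natVec (nextQueue z.1.1 z.2 z.1.2)) : ℝ) -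
    inner ℝ g (natVec z.1.1)) (ρ.prod (arrivalLaw arr)) := i1.sub i2
  have i4 : Integrable (fun z => (inner ℝ g (natVec (nextQueue z.1.1 z.2 z.1.2)) : ℝ) -
    inner ℝ g (natVec z.1.1) - inner ℝ g (natVec z.2 - (1 - ε) • toVec ν))
    (ρ.prod (arrivalLaw arr)) := i3.sub hci
  simp only [hpt]
  refine ⟨i4.add (integrable_const _), ?_⟩
  rw [integral_add i4 (integrable_const _), integral_sub i3 hci, integral_sub i1 i2,
    h.integral_next (fun q => (inner ℝ g (natVec q) : ℝ)),
    h.integral_cur (fun q => (inner ℝ g (natVec q) : ℝ)), hc0, integral_const, probReal_univ,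
    one_smul]
  ring

/-- The quadratic drift identity in expectation. -/
lemma IsStationaryLaw.integral_drift (h : IsStationaryLaw arr μ ρ) {aMax : ℕ}
    (harr : ∀ i j, ∀ a ∈ (arr i j).support, a ≤ aMax)
    {ν : Fin n → Fin n → ℝ} (hν : IsSaturating n n₁ n₂ ν) {ε : ℝ}
    (hmean : ∀ i j, ∫ a, (a : ℝ) ∂(arr i j).toMeasure = (1 - ε) * ν i j)
    (hmom : Integrable (fun q => ‖natVec q‖ ^ 3) μ)
    {T : MatrixSpace n →L[ℝ] MatrixSpace n} (hT : T = (portSpace n n₁ n₂).starProjection) :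
    ∫ z, (2 * inner ℝ (T (natVec (nextQueue z.1.1 z.2 z.1.2)))
          (natVec (unusedService z.1.1 z.2 z.1.2)) -
        ‖T (natVec (unusedService z.1.1 z.2 z.1.2))‖ ^ 2) ∂(ρ.prod (arrivalLaw arr)) =
      2 * ε * ∫ q, inner ℝ (T (natVec q)) (toVec ν) ∂μ -
        (∑ i, ∑ j, T (EuclideanSpace.single (i, j) 1) (i, j) *
          variance (fun a : ℕ => (a : ℝ)) (arr i j).toMeasure) - ε ^ 2 * ‖T (toVec ν)‖ ^ 2 := by
  have hP := h.prob
  have hμP : IsProbabilityMeasure μ := by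
    rw [← h.map_fst]; exact Measure.isProbabilityMeasure_map Measurable.of_discrete.aemeasurable
  have hTn : ∀ x, ‖T x‖ ≤ ‖x‖ := fun x => by
    rw [hT]; exact Submodule.norm_starProjection_apply_le _ x
  have hlam : toVec (fun i j => (1 - ε) * ν i j) = (1 - ε) • toVec ν := by ext e; simp
  have j1 : Integrable (fun q => ‖T (natVec q)‖ ^ 2) μ :=
    integrable_of_cubic_bound hmom 1 fun q => by
      rw [abs_of_nonneg (by positivity), one_mul]
      refine le_trans ?_ (sq_le_one_add_cube (norm_nonneg _))
      have := hTn (natVec q)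
      gcongr
  have j2 : Integrable (fun q => (inner ℝ (T (natVec q)) (toVec ν) : ℝ)) μ :=
    integrable_of_cubic_bound hmom ‖toVec ν‖ fun q => by
      refine (abs_real_inner_le_norm _ _).trans ?_
      rw [mul_comm]
      refine mul_le_mul_of_nonneg_left ((hTn _).trans (le_one_add_cube (norm_nonneg _)))
        (norm_nonneg _)
  have j3 : Integrable (fun q => ‖T (natVec q)‖) μ :=
    integrable_of_cubic_bound hmom 1 fun q => by
      rw [abs_of_nonneg (by positivity), one_mul]
      exact (hTn _).trans (le_one_add_cube (norm_nonneg _))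
  have j3' : Integrable (fun z : QueueState n × Equiv.Perm (Fin n) => ‖T (natVec z.1)‖) ρ := by
    rw [← h.map_fst] at j3
    exact j3.comp_measurable Measurable.of_discrete
  obtain ⟨hci, hc0⟩ := integral_inner_centered (arr := arr) (ρ := ρ) harr hmean
    (v := fun q => T (natVec q)) j3'
  obtain ⟨hdi, hd0⟩ := integral_inner_centered (arr := arr) (ρ := ρ) harr hmean
    (v := fun _ => T (toVec ν)) (integrable_const _)
  obtain ⟨hvi, hv⟩ := integral_sq_norm_starProjection_arrivals n₁ n₂ harr hmean
  rw [hlam] at hci hc0 hdi hd0 hvi hv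
  rw [← hT] at hvi hv
  have hvi' : Integrable (fun z : (QueueState n × Equiv.Perm (Fin n)) × QueueState n =>
      ‖T (natVec z.2 - (1 - ε) • toVec ν)‖ ^ 2) (ρ.prod (arrivalLaw arr)) := hvi.comp_snd ρ
  have hv' : ∫ z : (QueueState n × Equiv.Perm (Fin n)) × QueueState n,
      ‖T (natVec z.2 - (1 - ε) • toVec ν)‖ ^ 2 ∂(ρ.prod (arrivalLaw arr)) =
      ∫ a, ‖T (natVec a - (1 - ε) • toVec ν)‖ ^ 2 ∂(arrivalLaw arr) := by
    rw [integral_fun_snd (fun a => ‖T (natVec a - (1 - ε) • toVec ν)‖ ^ 2)]; simp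
  simp only [hν.drift_identity ε _ _ _ hT]
  have i1 := h.integrable_next j1
  have i2 := h.integrable_cur j1
  have i4 := (h.integrable_cur j2).const_mul (2 * ε)
  have i3 := hci.const_mul 2
  have i6 := hdi.const_mul (2 * ε)
  have k1 := i1.sub i2
  have k2 := k1.sub i3
  have k3 := k2.add i4
  have k4 := k3.sub hvi'
  have k5 := k4.add i6
  have e1 := integral_sub k5 (integrable_const (ε ^ 2 * ‖T (toVec ν)‖ ^ 2))
  have e2 := integral_add k4 i6
  have e3 := integral_sub k3 hvi'
  have e4 := integral_add k2 i4
  have e5 := integral_sub k1 i3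
  have e6 := integral_sub i1 i2
  simp only [Pi.add_apply, Pi.sub_apply] at e1 e2 e3 e4 e5 e6
  rw [e1, e2, e3, e4, e5, e6, h.integral_next (fun q => ‖T (natVec q)‖ ^ 2),
    h.integral_cur (fun q => ‖T (natVec q)‖ ^ 2), integral_const_mul, integral_const_mul,
    integral_const_mul, hc0, hd0, hv', hv,
    h.integral_cur (fun q => (inner ℝ (T (natVec q)) (toVec ν) : ℝ)), integral_const,
    probReal_univ, one_smul]
  ring

end

/-! ### Heavy traffic limits -/

section

variable {n n₁ n₂ : ℕ} {arr : Fin n → Fin n → PMF ℕ} {μ : Measure (QueueState n)}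
  {ρ : Measure (QueueState n × Equiv.Perm (Fin n))}

lemma integrable_queue [IsFiniteMeasure μ] (hmom : Integrable (fun q => ‖natVec q‖ ^ 3) μ)
    (i j : Fin n) : Integrable (fun q : QueueState n => (q i j : ℝ)) μ :=
  integrable_of_cubic_bound hmom 1 fun q => by
    rw [one_mul]
    exact (PiLp.norm_apply_le (natVec q) (i, j)).trans (le_one_add_cube (norm_nonneg _))

/-- Queue lengths of a stationary switch below capacity have finite third moments. -/
lemma IsStationaryLaw.integrable_cube (h : IsStationaryLaw arr μ ρ) {aMax : ℕ}
    (harr : ∀ i j, ∀ a ∈ (arr i j).support, a ≤ aMax)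
    {ν : Fin n → Fin n → ℝ} (hν : IsSaturating n n₁ n₂ ν) {ε : ℝ} (h0 : 0 < ε) (h1 : ε < 1)
    (hmean : ∀ i j, ∫ a, (a : ℝ) ∂(arr i j).toMeasure = (1 - ε) * ν i j) :
    Integrable (fun q => ‖natVec q‖ ^ 3) μ := by
  -- The collapse bound is used for the rates `(1 - ε) ν`, which saturate no port, with load
  -- parameter 0. The constant may depend on `ε`; only finiteness matters.
  obtain ⟨ε₀, hε₀, C, hb⟩ := (hν.scale h0 h1).exists_moment_bound aMax
  have := (hb 0 arr μ ρ le_rfl hε₀.le h harr (by simpa using hmean)).1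
  simpa only [polarPart_zero_zero] using this

lemma integral_norm_polarPart_le [IsProbabilityMeasure μ]
    (hmom : Integrable (fun q => ‖natVec q‖ ^ 3) μ) {C : ℝ}
    (hC : ∫ q, ‖polarPart n n₁ n₂ (natVec q)‖ ^ 3 ∂μ ≤ C) :
    (Integrable (fun q => ‖polarPart n n₁ n₂ (natVec q)‖) μ ∧
      ∫ q, ‖polarPart n n₁ n₂ (natVec q)‖ ∂μ ≤ 1 + C) ∧
    (Integrable (fun q => ‖polarPart n n₁ n₂ (natVec q)‖ ^ 2) μ ∧
      ∫ q, ‖polarPart n n₁ n₂ (natVec q)‖ ^ 2 ∂μ ≤ 1 + C) := by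
  have hp : ∀ q : QueueState n, ‖polarPart n n₁ n₂ (natVec q)‖ ≤ ‖natVec q‖ :=
    fun q => norm_polarPart_le n₁ n₂ _
  have i3 : Integrable (fun q => ‖polarPart n n₁ n₂ (natVec q)‖ ^ 3) μ :=
    integrable_of_cubic_bound hmom 1 fun q => by
      rw [abs_of_nonneg (by positivity), one_mul]
      have := hp q
      have h3 : ‖polarPart n n₁ n₂ (natVec q)‖ ^ 3 ≤ ‖natVec q‖ ^ 3 := by gcongr
      linarith
  have i1 : Integrable (fun q => ‖polarPart n n₁ n₂ (natVec q)‖) μ :=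
    integrable_of_cubic_bound hmom 1 fun q => by
      rw [abs_of_nonneg (norm_nonneg _), one_mul]
      exact (hp q).trans (le_one_add_cube (norm_nonneg _))
  have i2 : Integrable (fun q => ‖polarPart n n₁ n₂ (natVec q)‖ ^ 2) μ :=
    integrable_of_cubic_bound hmom 1 fun q => by
      rw [abs_of_nonneg (by positivity), one_mul]
      have := hp q
      have h3 : ‖polarPart n n₁ n₂ (natVec q)‖ ^ 2 ≤ ‖natVec q‖ ^ 2 := by gcongr
      exact h3.trans (sq_le_one_add_cube (norm_nonneg _))
  have hsum : ∫ q, (1 + ‖polarPart n n₁ n₂ (natVec q)‖ ^ 3) ∂μ ≤ 1 + C := by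
    rw [integral_add (integrable_const _) i3, integral_const, probReal_univ, one_smul]
    linarith
  exact ⟨⟨i1, (integral_mono i1 ((integrable_const 1).add i3)
      fun q => le_one_add_cube (norm_nonneg _)).trans hsum⟩,
    i2, (integral_mono i2 ((integrable_const 1).add i3)
      fun q => sq_le_one_add_cube (norm_nonneg _)).trans hsum⟩

/-- Queues between unsaturated ports have bounded means. -/
lemma integral_queue_le_of_unsaturated [IsProbabilityMeasure μ]
    (hmom : Integrable (fun q => ‖natVec q‖ ^ 3) μ) {C : ℝ}
    (hC : ∫ q, ‖polarPart n n₁ n₂ (natVec q)‖ ^ 3 ∂μ ≤ C) {i j : Fin n}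
    (hi : n₁ ≤ (i : ℕ)) (hj : n₂ ≤ (j : ℕ)) : ∫ q, (q i j : ℝ) ∂μ ≤ 1 + C := by
  obtain ⟨⟨i1, h1⟩, -⟩ := integral_norm_polarPart_le hmom hC
  refine (integral_mono (integrable_queue hmom i j) i1 fun q => ?_).trans h1
  -- Hence `q i j` is itself an entry of the collapse error.
  have h0 : (portSpace n n₁ n₂).starProjection (natVec q) (i, j) = 0 :=
    apply_eq_zero_of_mem_portSpace (Submodule.starProjection_apply_mem _ _) hi hj
  have h2 := (PiLp.norm_apply_le (natVec q - (portSpace n n₁ n₂).starProjection (natVec q))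
    (i, j)).trans (norm_sub_starProjection_le n₁ n₂ (natVec q))
  rw [PiLp.sub_apply, h0, sub_zero, natVec_apply, Real.norm_natCast] at h2
  exact h2

/-- The terms with unused service in the drift identity are negligible. -/
lemma IsStationaryLaw.abs_integral_unused_le (h : IsStationaryLaw arr μ ρ) {aMax : ℕ}
    (harr : ∀ i j, ∀ a ∈ (arr i j).support, a ≤ aMax)
    {ν : Fin n → Fin n → ℝ} (hν : IsSaturating n n₁ n₂ ν) {ε η C : ℝ} (hη : 0 < η)
    (hmean : ∀ i j, ∫ a, (a : ℝ) ∂(arr i j).toMeasure = (1 - ε) * ν i j)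
    (hmom : Integrable (fun q => ‖natVec q‖ ^ 3) μ)
    (hC : ∫ q, ‖polarPart n n₁ n₂ (natVec q)‖ ^ 3 ∂μ ≤ C)
    {T : MatrixSpace n →L[ℝ] MatrixSpace n} (hT : T = (portSpace n n₁ n₂).starProjection) :
    |∫ z, (2 * inner ℝ (T (natVec (nextQueue z.1.1 z.2 z.1.2)))
          (natVec (unusedService z.1.1 z.2 z.1.2)) -
        ‖T (natVec (unusedService z.1.1 z.2 z.1.2))‖ ^ 2) ∂(ρ.prod (arrivalLaw arr))| ≤
      η * (1 + C) + (2 * (n : ℝ) ^ 2 / η + n) * (ε * inner ℝ (portVec n n₁ n₂) (toVec ν)) := by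
  have hP := h.prob
  have hμP : IsProbabilityMeasure μ := by
    rw [← h.map_fst]; exact Measure.isProbabilityMeasure_map Measurable.of_discrete.aemeasurable
  obtain ⟨-, i2, h2⟩ := integral_norm_polarPart_le hmom hC
  obtain ⟨hNi, hN⟩ := h.integral_unusedService harr hν hmean hmom
  have j2 := (h.integrable_next i2).const_mul η
  have jN := hNi.const_mul (2 * (n : ℝ) ^ 2 / η + n)
  have hb : ∀ z : (QueueState n × Equiv.Perm (Fin n)) × QueueState n,
      ‖2 * inner ℝ (T (natVec (nextQueue z.1.1 z.2 z.1.2)))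
          (natVec (unusedService z.1.1 z.2 z.1.2)) -
        ‖T (natVec (unusedService z.1.1 z.2 z.1.2))‖ ^ 2‖ ≤
      η * ‖polarPart n n₁ n₂ (natVec (nextQueue z.1.1 z.2 z.1.2))‖ ^ 2 +
        (2 * (n : ℝ) ^ 2 / η + n) *
          inner ℝ (portVec n n₁ n₂) (natVec (unusedService z.1.1 z.2 z.1.2)) := by
    rintro ⟨⟨q, s⟩, a⟩
    simp only
    have e1 := abs_inner_nextQueue_unusedService_le (n₁ := n₁) (n₂ := n₂) q a s
    have e2 := sq_norm_starProjection_unusedService_le (n₁ := n₁) (n₂ := n₂) q a s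
    have e3 := inner_portVec_unusedService_nonneg (n₁ := n₁) (n₂ := n₂) q a s
    have e4 := inner_portVec_unusedService_le (n₁ := n₁) (n₂ := n₂) q a s
    rw [← hT] at e1 e2
    set N : ℝ := inner ℝ (portVec n n₁ n₂) (natVec (unusedService q a s))
    set d := ‖polarPart n n₁ n₂ (natVec (nextQueue q a s))‖
    -- Young's inequality with weight `η`, then `N² ≤ 2n² N`, so that only the mean of `N` is
    -- needed.
    have e5 : 2 * (d * N) ≤ η * d ^ 2 + 2 * (n : ℝ) ^ 2 / η * N := by
      have e6 : N * N ≤ 2 * (n : ℝ) ^ 2 * N := mul_le_mul_of_nonneg_right e4 e3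
      have e7 : 0 ≤ (η * d - N) ^ 2 / η := by positivity
      have e8 : (η * d - N) ^ 2 / η = η * d ^ 2 - 2 * (d * N) + N * N / η := by
        field_simp; ring
      have e9 : N * N / η ≤ 2 * (n : ℝ) ^ 2 / η * N := by
        rw [div_mul_eq_mul_div]; gcongr
      linarith
    have e6 := sq_nonneg ‖T (natVec (unusedService q a s))‖
    rw [abs_le] at e1
    rw [Real.norm_eq_abs, abs_le]
    constructor <;> linarith
  refine (norm_integral_le_of_norm_le (j2.add jN) (Eventually.of_forall hb)).trans ?_
  simp only [Pi.add_apply]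
  rw [integral_add j2 jN, integral_const_mul, integral_const_mul, hN,
    h.integral_next (fun q => ‖polarPart n n₁ n₂ (natVec q)‖ ^ 2)]
  gcongr

/-- Quantitative form of the heavy traffic limit. -/
lemma IsStationaryLaw.abs_scaled_queue_sub_le (h : IsStationaryLaw arr μ ρ) {aMax : ℕ}
    (hn : 0 < n) (harr : ∀ i j, ∀ a ∈ (arr i j).support, a ≤ aMax)
    {ν : Fin n → Fin n → ℝ} (hν : IsSaturating n n₁ n₂ ν) {ε η C : ℝ} (hε : 0 ≤ ε) (hη : 0 < η)
    (hmean : ∀ i j, ∫ a, (a : ℝ) ∂(arr i j).toMeasure = (1 - ε) * ν i j)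
    (hmom : Integrable (fun q => ‖natVec q‖ ^ 3) μ)
    (hC : ∫ q, ‖polarPart n n₁ n₂ (natVec q)‖ ^ 3 ∂μ ≤ C)
    {T : MatrixSpace n →L[ℝ] MatrixSpace n} (hT : T = (portSpace n n₁ n₂).starProjection) :
    |ε * ∫ q, (∑ i, ∑ j, (q i j : ℝ)) ∂μ - n / 2 * ∑ i, ∑ j,
        T (EuclideanSpace.single (i, j) 1) (i, j) *
          variance (fun a : ℕ => (a : ℝ)) (arr i j).toMeasure| ≤
      ε * (n * (1 + C)) + n / 2 * (ε ^ 2 * ‖T (toVec ν)‖ ^ 2 + (η * (1 + C) +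
        (2 * (n : ℝ) ^ 2 / η + n) * (ε * inner ℝ (portVec n n₁ n₂) (toVec ν)))) := by
  have hP := h.prob
  have hμP : IsProbabilityMeasure μ := by
    rw [← h.map_fst]; exact Measure.isProbabilityMeasure_map Measurable.of_discrete.aemeasurable
  have hn' : (0 : ℝ) < n := by exact_mod_cast hn
  have hdrift := h.integral_drift harr hν hmean hmom hT
  have hR := h.abs_integral_unused_le harr hν hη hmean hmom hC hT
  rw [hdrift] at hR
  obtain ⟨⟨i1, h1⟩, -⟩ := integral_norm_polarPart_le hmom hC
  have hTmem : ∀ x, T x ∈ portSpace n n₁ n₂ := fun x => by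
    rw [hT]; exact Submodule.starProjection_apply_mem _ _
  have hTi : Integrable (fun q => (inner ℝ (T (natVec q)) (onesVec n) : ℝ)) μ :=
    integrable_of_cubic_bound hmom ‖onesVec n‖ fun q => by
      refine (abs_real_inner_le_norm _ _).trans ?_
      rw [mul_comm]
      refine mul_le_mul_of_nonneg_left (le_trans ?_ (le_one_add_cube (norm_nonneg _)))
        (norm_nonneg _)
      rw [hT]; exact Submodule.norm_starProjection_apply_le _ _
  have hqi : Integrable (fun q : QueueState n => ∑ i, ∑ j, (q i j : ℝ)) μ :=
    integrable_finsetSum _ fun i _ => integrable_finsetSum _ fun j _ => integrable_queue hmom i j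
  -- Replacing `q` by its projection changes the mean total by a bounded amount, which the factor
  -- `ε` makes negligible.
  have hdiff : |∫ q, (∑ i, ∑ j, (q i j : ℝ)) ∂μ - ∫ q, inner ℝ (T (natVec q)) (onesVec n) ∂μ| ≤
      n * (1 + C) := by
    rw [← integral_sub hqi hTi, ← Real.norm_eq_abs]
    refine (norm_integral_le_of_norm_le (i1.const_mul (n : ℝ))
      (Eventually.of_forall fun q => ?_)).trans ?_
    · have e1 : ∑ i, ∑ j, (q i j : ℝ) = inner ℝ (natVec q) (onesVec n) := by
        rw [inner_onesVec]; rfl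
      rw [e1, ← inner_sub_left, Real.norm_eq_abs]
      refine (abs_real_inner_le_norm _ _).trans ?_
      rw [norm_onesVec, mul_comm]
      refine mul_le_mul_of_nonneg_left ?_ hn'.le
      rw [hT]; exact norm_sub_starProjection_le n₁ n₂ _
    · rw [integral_const_mul]; gcongr
  have hTν : ∫ q, inner ℝ (T (natVec q)) (toVec ν) ∂μ =
      (∫ q, inner ℝ (T (natVec q)) (onesVec n) ∂μ) / n := by
    rw [← integral_div]
    exact integral_congr_ae (Eventually.of_forall fun q => hν.inner_eq hn (hTmem _))
  rw [hTν] at hR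
  set A := ∫ q, (∑ i, ∑ j, (q i j : ℝ)) ∂μ
  set B := ∫ q, inner ℝ (T (natVec q)) (onesVec n) ∂μ
  set S := ∑ i, ∑ j, T (EuclideanSpace.single (i, j) 1) (i, j) *
          variance (fun a : ℕ => (a : ℝ)) (arr i j).toMeasure
  set Q := η * (1 + C) + (2 * (n : ℝ) ^ 2 / η + n) * (ε * inner ℝ (portVec n n₁ n₂) (toVec ν))
  have hdec : ε * A - n / 2 * S = ε * (A - B) + n / 2 * (ε ^ 2 * ‖T (toVec ν)‖ ^ 2 +
      (2 * ε * (B / n) - S - ε ^ 2 * ‖T (toVec ν)‖ ^ 2)) := by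
    field_simp; ring
  rw [hdec]
  refine (abs_add_le _ _).trans (add_le_add ?_ ?_)
  · rw [abs_mul, abs_of_nonneg hε]; gcongr
  · rw [abs_mul, abs_of_nonneg (by positivity : (0 : ℝ) ≤ n / 2)]
    refine mul_le_mul_of_nonneg_left ((abs_add_le _ _).trans (add_le_add ?_ hR)) (by positivity)
    rw [abs_of_nonneg (by positivity)]

end

theorem mainTheorem6 {n n₁ n₂ : ℕ} (hn₁ : n₁ < n) (hn₂ : n₂ < n)
    (ν : Fin n → Fin n → ℝ)
    (hν : ν ∈ intrinsicInterior ℝ (saturatedFace n n₁ n₂))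
    (hνpos : ∀ i j, 0 < ν i j)
    (aMax : ℕ)
    (arr : ℝ → Fin n → Fin n → PMF ℕ)
    (harr : ∀ ε ∈ Set.Ioo (0 : ℝ) 1, ∀ i j, ∀ a ∈ (arr ε i j).support, a ≤ aMax)
    (hmean : ∀ ε ∈ Set.Ioo (0 : ℝ) 1, ∀ i j,
      ∫ a, (a : ℝ) ∂(arr ε i j).toMeasure = (1 - ε) * ν i j)
    (σ : Fin n → Fin n → ℝ)
    (hvar : ∀ i j,
      Tendsto (fun ε : ℝ => variance (fun a : ℕ => (a : ℝ)) (arr ε i j).toMeasure)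
        (𝓝[>] 0) (𝓝 (σ i j ^ 2)))
    (rule : ℝ → QueueState n → PMF (Equiv.Perm (Fin n)))
    (hrule : ∀ ε ∈ Set.Ioo (0 : ℝ) 1, IsMaxWeightRule (rule ε))
    (steady : ℝ → ProbabilityMeasure (QueueState n))
    (hsteady : ∀ ε ∈ Set.Ioo (0 : ℝ) 1,
      Kernel.Invariant (queueKernel (arr ε) (rule ε)) (steady ε : Measure (QueueState n))) :
    (∀ ε ∈ Set.Ioo (0 : ℝ) 1, ∀ i j,
      Integrable (fun q : QueueState n => (q i j : ℝ)) (steady ε : Measure (QueueState n))) ∧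
    Tendsto
      (fun ε : ℝ => ε * ∫ q, (∑ i, ∑ j, (q i j : ℝ)) ∂(steady ε : Measure (QueueState n)))
      (𝓝[>] 0) (𝓝 (1 / 2 * ∑ i, ∑ j, σ i j ^ 2 * zetaWeight n n₁ n₂ i j)) ∧
    (∀ i j : Fin n, n₁ ≤ (i : ℕ) → n₂ ≤ (j : ℕ) →
      Tendsto (fun ε : ℝ => ε * ∫ q, (q i j : ℝ) ∂(steady ε : Measure (QueueState n)))
        (𝓝[>] 0) (𝓝 0)) := by
  have hn : 0 < n := (Nat.zero_le _).trans_lt hn₁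
  have hsat := isSaturating_of_mem_intrinsicInterior hn₁ hn₂ hν hνpos
  have hmom : ∀ ε ∈ Set.Ioo (0 : ℝ) 1,
      Integrable (fun q => ‖natVec q‖ ^ 3) (steady ε : Measure (QueueState n)) := by
    intro ε hε
    obtain ⟨ρ, hρ⟩ := exists_isStationaryLaw (hrule ε hε) (hsteady ε hε)
    exact hρ.integrable_cube (harr ε hε) hsat hε.1 hε.2 (hmean ε hε)
  obtain ⟨ε₀, hε₀, C, hC⟩ := hsat.exists_moment_bound aMax
  have hsmall : ∀ᶠ ε in 𝓝[>] (0 : ℝ), ε ∈ Set.Ioo (0 : ℝ) 1 ∧ ε ≤ ε₀ :=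
    Filter.Eventually.and (Ioo_mem_nhdsGT one_pos)
      ((eventually_le_nhds hε₀).filter_mono nhdsWithin_le_nhds)
  have hbound : ∀ ε ∈ Set.Ioo (0 : ℝ) 1, ε ≤ ε₀ →
      ∫ q, ‖polarPart n n₁ n₂ (natVec q)‖ ^ 3 ∂(steady ε : Measure (QueueState n)) ≤ C := by
    intro ε hε hle
    obtain ⟨ρ, hρ⟩ := exists_isStationaryLaw (hrule ε hε) (hsteady ε hε)
    exact (hC ε _ _ ρ hε.1.le hle hρ (harr ε hε) (hmean ε hε)).2
  have hid : Tendsto (fun ε : ℝ => ε) (𝓝[>] 0) (𝓝 0) := nhdsWithin_le_nhds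
  refine ⟨fun ε hε i j => integrable_queue (hmom ε hε) i j, ?_, fun i j hi hj => ?_⟩
  · set T := (portSpace n n₁ n₂).starProjection with hT
    set c : ℝ := inner ℝ (portVec n n₁ n₂) (toVec ν)
    have hmain : Tendsto (fun ε : ℝ => (n : ℝ) / 2 * ∑ i, ∑ j,
        T (EuclideanSpace.single (i, j) 1) (i, j) *
          variance (fun a : ℕ => (a : ℝ)) (arr ε i j).toMeasure) (𝓝[>] 0)
        (𝓝 (1 / 2 * ∑ i, ∑ j, σ i j ^ 2 * zetaWeight n n₁ n₂ i j)) := by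
      have hlim : 1 / 2 * ∑ i, ∑ j, σ i j ^ 2 * zetaWeight n n₁ n₂ i j =
          (n : ℝ) / 2 * ∑ i, ∑ j, T (EuclideanSpace.single (i, j) 1) (i, j) * σ i j ^ 2 := by
        simp only [← starProjection_portSpace_diag hn₁ hn₂, Finset.mul_sum]
        exact Finset.sum_congr rfl fun i _ => Finset.sum_congr rfl fun j _ => by ring
      rw [hlim]
      exact (tendsto_finsetSum _ fun i _ => tendsto_finsetSum _ fun j _ =>
        (hvar i j).const_mul _).const_mul _
    have herr : Tendsto (fun ε : ℝ => ε * (n * (1 + C)) + (n : ℝ) / 2 *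
        (ε ^ 2 * ‖T (toVec ν)‖ ^ 2 + (√ε * (1 + C) +
          (2 * (n : ℝ) ^ 2 * √ε + n * ε) * c))) (𝓝[>] 0) (𝓝 0) := by
      have hcont : Continuous fun ε : ℝ => ε * (n * (1 + C)) + (n : ℝ) / 2 *
          (ε ^ 2 * ‖T (toVec ν)‖ ^ 2 + (√ε * (1 + C) +
            (2 * (n : ℝ) ^ 2 * √ε + n * ε) * c)) := by fun_prop
      simpa using (hcont.tendsto 0).mono_left nhdsWithin_le_nhds
    have hdiff := squeeze_zero_norm' (a := fun ε : ℝ => ε * (n * (1 + C)) + (n : ℝ) / 2 *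
        (ε ^ 2 * ‖T (toVec ν)‖ ^ 2 + (√ε * (1 + C) +
          (2 * (n : ℝ) ^ 2 * √ε + n * ε) * c)))
      (f := fun ε : ℝ => ε * ∫ q, (∑ i, ∑ j, (q i j : ℝ)) ∂(steady ε : Measure (QueueState n)) -
        (n : ℝ) / 2 * ∑ i, ∑ j, T (EuclideanSpace.single (i, j) 1) (i, j) *
          variance (fun a : ℕ => (a : ℝ)) (arr ε i j).toMeasure) ?_ herr
    · simpa using hdiff.add hmain
    · filter_upwards [hsmall] with ε hε
      obtain ⟨ρ, hρ⟩ := exists_isStationaryLaw (hrule ε hε.1) (hsteady ε hε.1)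
      -- The weight `η = √ε` balances `η` against `ε / η`, so both errors tend to zero.
      have hb := hρ.abs_scaled_queue_sub_le hn (harr ε hε.1) hsat hε.1.1.le
        (Real.sqrt_pos.2 hε.1.1) (hmean ε hε.1) (hmom ε hε.1) (hbound ε hε.1 hε.2) hT
      have hrew : (2 * (n : ℝ) ^ 2 / √ε + n) * (ε * c) =
          (2 * (n : ℝ) ^ 2 * √ε + n * ε) * c := by
        calc _ = (2 * (n : ℝ) ^ 2 * (ε / √ε) + n * ε) * c := by ring
          _ = _ := by rw [Real.div_sqrt]
      rw [hrew] at hb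
      exact hb
  · have hlim : Tendsto (fun ε : ℝ => ε * (1 + C)) (𝓝[>] 0) (𝓝 0) := by
      simpa using hid.mul_const (1 + C)
    refine squeeze_zero' ?_ ?_ hlim
    · filter_upwards [hsmall] with ε hε
      exact mul_nonneg hε.1.1.le (integral_nonneg fun q => Nat.cast_nonneg _)
    · filter_upwards [hsmall] with ε hε
      exact mul_le_mul_of_nonneg_left (integral_queue_le_of_unsaturated (hmom ε hε.1)
        (hbound ε hε.1 hε.2) hi hj) hε.1.1.le
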